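/- Let $d\ge 1$, let $a,b\in\mathbb R^d$ with $a^k<b^k$ for $k=1,\dots,d$, and let $K=[a^1,b^1]\times\cdots\times[a^d,b^d]=K_1\times K_2$ with $K_1=[a^1,b^1]$ and $K_2=\prod_{k=2}^d[a^k,b^k]$ (a single point if $d=1$). Write $\mathcal V=\prod_{k}\{a^k,b^k\}$. For $x\in K$ and $\rho\in\mathcal V$ let $Q(\rho,x)\subset K$ be the product of the intervals $[a^k,x^k)$ (if $\rho^k=a^k$) and $(x^k,b^k]$ (if $\rho^k=b^k$). A number $l$ is the $\rho$-limit of $f:K\to\mathbb R$ at $x$ if $f(x_m)\to l$ for every sequence $(x_m)\subset Q(\rho,x)$ with $x_m\to x$ (a void condition if $Q(\rho,x)=\emptyset$). The function $f$ is continuous from above at $x$ if $f(x)$ is its $\rho_x$-limit at $x$, where $\rho_x^k=b^k$ if $x^k<b^k$ and $\rho_x^k=a^k$ if $x^k=b^k$. Let $\mathcal D_K$ be the set of all $f:K\to\mathbb R$ that have a $\rho$-limit at $x$ for all $\rho\in\mathcal V$, $x\in K$, and are continuous from above at every $x\in K$. Let $\widetilde{\mathcal D}_K$ be the set of all $f\in\mathcal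 D_K$ such that $f(t,\cdot)$ is continuous on $K_2$ for every $t\in K_1$ and $f(\cdot,\xi)$ is càdlàg on $K_1$ for every $\xi\in K_2$. For a compact interval $I$ let $\Lambda_I$ be the set of strictly increasing surjections $\lambda:I\to I$, and put $|||\lambda|||_I=\sup_{s\ne t}\bigl|\log\frac{\lambda(t)-\lambda(s)}{t-s}\bigr|\in[0,\infty]$. Let $\Lambda_K=\prod_k\Lambda_{[a^k,b^k]}$, acting on $K$ coordinatewise, $|||\lambda|||_K=\max_k|||\lambda_k|||_{[a^k,b^k]}$ and $\|h\|_K=\sup_{x\in K}|h(x)|$. For $f,g\in\mathcal D_K$ set $$d_K(f,g)=\inf_{\lambda\in\Lambda_K}\bigl\{|||\lambda|||_K+\|f-g\circ\lambda\|_K\bigr\},\qquad \widetilde d_K(f,g)=\inf_{\lambda\in\Lambda_{K_1}}\Bigl\{|||\lambda|||_{K_1}+\sup_{(t,\xi)\in K_1\times K_2}|f(t,\xi)-g(\lambda(t),\xi)|\Bigr\}.$$ For a metric $\delta$ on $\mathcal D_K$ write $B^{\delta}_r(f)=\{g\in\mathcal D_K:\delta(f,g)<r\}$. Then: 1. $d_K$,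 $\widetilde d_K$ and the sup-norm distance $(f,g)\mapsto\|f-g\|_K$ are (finite) metrics on $\mathcal D_K$. 2. $d_K(f,g)\le\widetilde d_K(f,g)\le\|f-g\|_K$ for all $f,g\in\mathcal D_K$. 3. If $f\in\widetilde{\mathcal D}_K$, then for every $r>0$ there is $\delta>0$ with $B^{d_K}_\delta(f)\subset B^{\widetilde d_K}_r(f)$. Moreover, $d_K$ and $\widetilde d_K$ generate the same topology on $\widetilde{\mathcal D}_K$. 4. Every continuous $f:K\to\mathbb R$ belongs to $\mathcal D_K$, and for every such $f$ and every $r>0$ there is $\delta>0$ with $B^{\widetilde d_K}_\delta(f)\subset B^{\|\cdot\|_K}_r(f)$. Moreover, $d_K$, $\widetilde d_K$ and $\|\cdot\|_K$ generate the same topology on the space of continuous functions on $K$. 5. $(\mathcal D_K,d_K)$ is a Polish space, $\widetilde{\mathcal D}_K$ is closed in it, and $(\widetilde{\mathcal D}_K,\widetilde d_K)$ is a Polish space. -/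

import Mathlib

open Set Filter Topology
open scoped ENNReal

namespace Skorohod

/-! ### Metrics on sets of functions -/

section Metrics

variable {X : Type*}

/-- `d` is a (finite) metric on the set `S`. -/
structure IsMetricOn (S : Set X) (d : X → X → ℝ≥0∞) : Prop where
  lt_top : ∀ f ∈ S, ∀ g ∈ S, d f g < ∞
  eq_zero_iff : ∀ f ∈ S, ∀ g ∈ S, d f g = 0 ↔ f = g
  symm : ∀ f ∈ S, ∀ g ∈ S, d f g = d g f
  triangle : ∀ f ∈ S, ∀ g ∈ S, ∀ h ∈ S, d f h ≤ d f g + d g h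

/-- The open ball in `S` of center `f` and radius `r`, with respect to `d`. -/
def ballIn (S : Set X) (d : X → X → ℝ≥0∞) (f : X) (r : ℝ) : Set X :=
  {g | g ∈ S ∧ d f g < ENNReal.ofReal r}

/-- The topology on `S` generated by `d`: a set is open iff it contains, with each of its points,
an open ball of positive radius about that point. -/
@[reducible] def topologyOn (S : Set X) (d : X → X → ℝ≥0∞) : TopologicalSpace S where
  IsOpen U := ∀ f ∈ U, ∃ r : ℝ, 0 < r ∧ ∀ g : S, (g : X) ∈ ballIn S d f r → g ∈ U
  isOpen_univ := fun _ _ => ⟨1, one_pos, fun _ _ => mem_univ _⟩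
  isOpen_inter := by
    intro U V hU hV f hf
    obtain ⟨r, hr, hrU⟩ := hU f hf.1
    obtain ⟨s, hs, hsV⟩ := hV f hf.2
    exact ⟨min r s, lt_min hr hs, fun g hg =>
      ⟨hrU g ⟨hg.1, hg.2.trans_le (ENNReal.ofReal_le_ofReal (min_le_left r s))⟩,
       hsV g ⟨hg.1, hg.2.trans_le (ENNReal.ofReal_le_ofReal (min_le_right r s))⟩⟩⟩
  isOpen_sUnion := by
    rintro 𝒰 h𝒰 f ⟨U, hU, hf⟩
    obtain ⟨r, hr, hrU⟩ := h𝒰 U hU f hf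
    exact ⟨r, hr, fun g hg => ⟨U, hU, hrU g hg⟩⟩

end Metrics

/-! ### Quadrants and the Skorohod space

The compact rectangle `K = [a⁰,b⁰] × ⋯ × [aⁿ,bⁿ]` in dimension `d = n + 1` is the product type
`∀ k : Fin (n + 1), Icc (a k) (b k)`. A vertex `ρ` of `K` is coded by a function
`Fin (n + 1) → Bool`: the `k`-th coordinate of `ρ` is `b k` if `ρ k = true`, and `a k` if
`ρ k = false`. -/

/-- The side `[u, t)` (for `s = false`) or `(t, v]` (for `s = true`) of `t` in `[u, v]`. -/
def sideI {u v : ℝ} (s : Bool) (t : Icc u v) : Set (Icc u v) :=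
  if s = true then Ioi t else Iio t

open Classical in
/-- For `t < v`: the side `[u, t)` (for `s = false`) or `[t, v]` (for `s = true`) of `t`
in `[u, v]`. For `t = v`: the whole interval (for `s = false`) or `∅` (for `s = true`). -/
noncomputable def sideJ {u v : ℝ} (s : Bool) (t : Icc u v) : Set (Icc u v) :=
  if (t : ℝ) < v then (if s = true then Ici t else Iio t)
  else (if s = true then ∅ else univ)

/-- The rectangle `K`. -/
abbrev Rect {n : ℕ} (a b : Fin (n + 1) → ℝ) : Type := ∀ k : Fin (n + 1), Icc (a k) (b k)

/-- The first factor `K₁ = [a⁰,b⁰]` of `K`. -/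
abbrev Rect₁ {n : ℕ} (a b : Fin (n + 1) → ℝ) : Type := Icc (a 0) (b 0)

/-- The product `K₂ = [a¹,b¹] × ⋯ × [aⁿ,bⁿ]` of the remaining factors of `K`. -/
abbrev Rect₂ {n : ℕ} (a b : Fin (n + 1) → ℝ) : Type :=
  ∀ k : Fin n, Icc (a k.succ) (b k.succ)

section Space

variable {n : ℕ} {a b : Fin (n + 1) → ℝ}

/-- The point `(t, ξ)` of `K = K₁ × K₂`. -/
def pt (t : Rect₁ a b) (ξ : Rect₂ a b) : Rect a b :=
  Fin.cons (α := fun k : Fin (n + 1) => Icc (a k) (b k)) t ξ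

/-- The open quadrant `Q(ρ, x)`. -/
def quadrant (ρ : Fin (n + 1) → Bool) (x : Rect a b) : Set (Rect a b) :=
  {y | ∀ k, y k ∈ sideI (ρ k) (x k)}

/-- The quadrant `Q̃(ρ, x)`; for fixed `x` these partition `K` as `ρ` varies. -/
def quadrant' (ρ : Fin (n + 1) → Bool) (x : Rect a b) : Set (Rect a b) :=
  {y | ∀ k, y k ∈ sideJ (ρ k) (x k)}

/-- `l` is the `ρ`-limit of `f` at `x`: `f` tends to `l` along `Q(ρ, x)` at `x`. (If `Q(ρ, x)` is
empty there is nothing to approach along, and the condition is void.) -/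
def IsQuadrantLimit (f : Rect a b → ℝ) (ρ : Fin (n + 1) → Bool) (x : Rect a b) (l : ℝ) : Prop :=
  Tendsto f (𝓝[quadrant ρ x] x) (𝓝 l)

/-- `f` is continuous from above at `x`: `f x` is the `ρ`-limit of `f` at `x` for the one vertex
`ρ` with `x ∈ Q̃(ρ, x)`. This is the upper vertex `b` if `x k < b k` for all `k`; in a coordinate
with `x k = b k`, where nothing lies above `x k`, the limit is from below. -/
def ContinuousFromAboveAt (f : Rect a b → ℝ) (x : Rect a b) : Prop :=
  ∀ ρ : Fin (n + 1) → Bool, x ∈ quadrant' ρ x → IsQuadrantLimit f ρ x (f x)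

variable (a b)

/-- The Skorohod space `𝒟_K`. -/
def DK : Set (Rect a b → ℝ) :=
  {f | ∀ x, (∀ ρ, ∃ l, IsQuadrantLimit f ρ x l) ∧ ContinuousFromAboveAt f x}

/-- A function on an interval is càdlàg: right-continuous with left limits, at every point. -/
def IsCadlag {u v : ℝ} (h : Icc u v → ℝ) : Prop :=
  ∀ t, ContinuousWithinAt h (Ici t) t ∧ ∃ l, Tendsto h (𝓝[<] t) (𝓝 l)

/-- The space `𝒟̃_K` of those `f ∈ 𝒟_K` that are càdlàg in the first coordinate and continuous in
the remaining ones. -/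
def DKTilde : Set (Rect a b → ℝ) :=
  {f | f ∈ DK a b ∧ (∀ t : Rect₁ a b, Continuous fun ξ : Rect₂ a b => f (pt t ξ)) ∧
    ∀ ξ : Rect₂ a b, IsCadlag fun t : Rect₁ a b => f (pt t ξ)}

end Space

/-! ### The metrics

Increasing surjections of `[u, v]` onto itself are the order automorphisms
`Icc u v ≃o Icc u v`. Suprema and infima are taken in `[0, ∞]`, since the size of a time change
may be infinite. -/

/-- `|||lam|||`, the supremum over `s ≠ t` of `|log ((lam t - lam s) / (t - s))|`. -/
noncomputable def warpSize {u v : ℝ} (lam : Icc u v ≃o Icc u v) : ℝ≥0∞ :=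
  ⨆ (s : Icc u v) (t : Icc u v) (_ : s ≠ t),
    ENNReal.ofReal |Real.log (((lam t : ℝ) - (lam s : ℝ)) / ((t : ℝ) - (s : ℝ)))|

section Distances

variable {n : ℕ} {a b : Fin (n + 1) → ℝ}

/-- The sup-norm `‖h‖_K`. -/
noncomputable def supNorm (h : Rect a b → ℝ) : ℝ≥0∞ := ⨆ x, ENNReal.ofReal |h x|

/-- The sup-norm distance `‖f - g‖_K`. -/
noncomputable def supDist (f g : Rect a b → ℝ) : ℝ≥0∞ := supNorm (f - g)

/-- The Skorohod metric `d_K`: all coordinates are warped. -/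
noncomputable def dK (f g : Rect a b → ℝ) : ℝ≥0∞ :=
  ⨅ lam : ∀ k : Fin (n + 1), Icc (a k) (b k) ≃o Icc (a k) (b k),
    (⨆ k, warpSize (lam k)) + supNorm fun x => f x - g fun k => lam k (x k)

/-- The metric `d̃_K`: only the first coordinate is warped. -/
noncomputable def dKTilde (f g : Rect a b → ℝ) : ℝ≥0∞ :=
  ⨅ lam : Rect₁ a b ≃o Rect₁ a b,
    warpSize lam +
      ⨆ (t : Rect₁ a b) (ξ : Rect₂ a b), ENNReal.ofReal |f (pt t ξ) - g (pt (lam t) ξ)|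

end Distances

end Skorohod

open Skorohod

/-!
A small time change `lam` of an interval is bi-Lipschitz with slopes in `[exp (-c), exp c]`, where
`c` is its size, and conversely (`warpSize_le_ofReal_iff`). So small time changes are uniformly
close to the identity, and sizes are subadditive and invariant under inversion. Both `d_K` and
`d̃_K` are therefore uniform distances modulo a group of transformations with a penalty for the size
of the transformation (`warpDist`), which gives symmetry and the triangle inequality.

The functions in `𝒟_K` have limits not only along the open quadrants at a point, but also along the
half-open quadrants, which partition `K` (`exists_tendsto_quadrant'`). By compactness such a
function is uniformly approximated by step functions on finite grids (`exists_step_approx`). This yields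
boundedness, hence finiteness of the metrics. It also yields separability: a small time change moves
the grid points to rational points (`exists_orderIso_rat`; the displacement is a Lipschitz extension
from the grid), so that step functions with rational grid points and values are dense. That
`d_K f g = 0` forces `f = g` holds because a point of an open quadrant stays in it under small time
changes, and the values in the quadrants determine a function of `𝒟_K`.

For `f` in `𝒟̃_K`, the existence of quadrant limits and the continuity in the `K₂`-variable combine
to continuity in the `K₂`-variable uniformly over `K` (`exists_forall_fiber_dist_lt`). A small time
change of the `K₂`-variable can then be dropped at little cost, and this compares `d_K` to `d̃_K` at
`f`. For continuous `f` all time changes can be dropped, by uniform continuity.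

Completeness of `d_K`: if `f i` is close to `f (i + 1) ∘ lam i`, then with
`sig i = lam (i - 1) ∘ ⋯ ∘ lam 0` the functions `f i ∘ sig i` converge uniformly, to a function `g`
of `𝒟_K`, and `sig i` converges to a time change `mu` in the strong sense that the size of
`sig i ∘ mu⁻¹` tends to zero (`exists_orderIso_limit`); so `f i` converges to `g ∘ mu⁻¹`
(`exists_dK_limit`). Finally, `𝒟̃_K` is closed because it is stable under time changes and uniform
limits, and it inherits its Polish topology from `𝒟_K`.
-/

namespace Skorohod

/-! ### Time changes of an interval -/

section Warps

variable {u v : ℝ}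

theorem differenceQuotient_pos (lam : Icc u v ≃o Icc u v) {s t : Icc u v} (h : s ≠ t) :
    0 < ((lam t : ℝ) - lam s) / ((t : ℝ) - s) := by
  rcases lt_or_gt_of_ne h with h | h
  · exact div_pos (sub_pos.2 (lam.strictMono h)) (sub_pos.2 h)
  · exact div_pos_of_neg_of_neg (sub_neg.2 (lam.strictMono h)) (sub_neg.2 h)

theorem warpSize_le_iff_forall {lam : Icc u v ≃o Icc u v} {C : ℝ≥0∞} :
    warpSize lam ≤ C ↔ ∀ s t : Icc u v, s ≠ t →
      ENNReal.ofReal |Real.log (((lam t : ℝ) - (lam s : ℝ)) / ((t : ℝ) - (s : ℝ)))| ≤ C := by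
  simp only [warpSize, iSup_le_iff]

theorem ofReal_log_le_warpSize (lam : Icc u v ≃o Icc u v) {s t : Icc u v} (h : s ≠ t) :
    ENNReal.ofReal |Real.log (((lam t : ℝ) - (lam s : ℝ)) / ((t : ℝ) - (s : ℝ)))| ≤ warpSize lam :=
  warpSize_le_iff_forall.1 le_rfl s t h

@[simp] theorem warpSize_one : warpSize (1 : Icc u v ≃o Icc u v) = 0 := by
  refine le_antisymm (warpSize_le_iff_forall.2 fun s t h => ?_) bot_le
  have : (t : ℝ) - s ≠ 0 := sub_ne_zero.2 fun h' => h (Subtype.ext h'.symm)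
  simp [div_self this]

theorem warpSize_mul_le (lam mu : Icc u v ≃o Icc u v) :
    warpSize (lam * mu) ≤ warpSize lam + warpSize mu := by
  refine warpSize_le_iff_forall.2 fun s t h => ?_
  have h' : mu s ≠ mu t := fun h' => h (mu.injective h')
  have hne : ((mu t : ℝ) - mu s) ≠ 0 := sub_ne_zero.2 fun h'' => h' (Subtype.ext h''.symm)
  have key : (((lam * mu) t : ℝ) - (lam * mu) s) / ((t : ℝ) - s) =
      ((lam (mu t) : ℝ) - lam (mu s)) / ((mu t : ℝ) - mu s) * (((mu t : ℝ) - mu s) / (t - s)) := by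
    rw [div_mul_div_cancel₀ hne]; rfl
  rw [key, Real.log_mul (differenceQuotient_pos lam h').ne' (differenceQuotient_pos mu h).ne']
  calc _ ≤ ENNReal.ofReal (|Real.log (((lam (mu t) : ℝ) - lam (mu s)) / ((mu t : ℝ) - mu s))| +
        |Real.log (((mu t : ℝ) - mu s) / (t - s))|) := ENNReal.ofReal_le_ofReal (abs_add_le _ _)
    _ ≤ _ := ENNReal.ofReal_add_le.trans
        (add_le_add (ofReal_log_le_warpSize lam h') (ofReal_log_le_warpSize mu h))

theorem warpSize_inv_le (lam : Icc u v ≃o Icc u v) : warpSize lam⁻¹ ≤ warpSize lam := by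
  refine warpSize_le_iff_forall.2 fun s t h => ?_
  have h' : lam⁻¹ s ≠ lam⁻¹ t := fun h' => h (lam⁻¹.injective h')
  have := ofReal_log_le_warpSize lam h'
  rwa [RelIso.apply_inv_self, RelIso.apply_inv_self, ← inv_div, Real.log_inv, abs_neg] at this

@[simp] theorem warpSize_inv (lam : Icc u v ≃o Icc u v) : warpSize lam⁻¹ = warpSize lam :=
  le_antisymm (warpSize_inv_le lam) (by simpa using warpSize_inv_le lam⁻¹)

/-- The size of a time change is at most `c` iff all its difference quotients lie in
`[exp (-c), exp c]`. -/
theorem warpSize_le_ofReal_iff {lam : Icc u v ≃o Icc u v} {c : ℝ} (hc : 0 ≤ c) :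
    warpSize lam ≤ ENNReal.ofReal c ↔ ∀ s t : Icc u v, s ≤ t →
      Real.exp (-c) * ((t : ℝ) - s) ≤ (lam t : ℝ) - lam s ∧
        (lam t : ℝ) - lam s ≤ Real.exp c * ((t : ℝ) - s) := by
  have key : ∀ s t : Icc u v, s < t →
      (ENNReal.ofReal |Real.log (((lam t : ℝ) - (lam s : ℝ)) / ((t : ℝ) - (s : ℝ)))| ≤
        ENNReal.ofReal c ↔ Real.exp (-c) * ((t : ℝ) - s) ≤ (lam t : ℝ) - lam s ∧
        (lam t : ℝ) - lam s ≤ Real.exp c * ((t : ℝ) - s)) := by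
    intro s t hst
    have hpos := differenceQuotient_pos lam hst.ne
    have hts : 0 < (t : ℝ) - s := sub_pos.2 hst
    rw [ENNReal.ofReal_le_ofReal_iff hc, abs_le, Real.le_log_iff_exp_le hpos,
      Real.log_le_iff_le_exp hpos, le_div_iff₀ hts, div_le_iff₀ hts]
  rw [warpSize_le_iff_forall]
  constructor
  · intro h s t hst
    rcases hst.eq_or_lt with rfl | hst
    · simp
    · exact (key s t hst).1 (h s t hst.ne)
  · intro h s t hst
    rcases lt_or_gt_of_ne hst with hst | hst
    · exact (key s t hst).2 (h s t hst.le)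
    · have := (key t s hst).2 (h t s hst.le)
      rwa [← neg_div_neg_eq, neg_sub, neg_sub]

theorem coe_orderIso_left (huv : u ≤ v) (lam : Icc u v ≃o Icc u v) {t : Icc u v}
    (ht : (t : ℝ) = u) : (lam t : ℝ) = u := by
  have h : t ≤ lam.symm ⟨u, left_mem_Icc.2 huv⟩ := by
    change (t : ℝ) ≤ _
    rw [ht]; exact (lam.symm _).2.1
  have h2 := lam.monotone h
  rw [OrderIso.apply_symm_apply] at h2
  exact le_antisymm h2 (lam t).2.1

theorem coe_orderIso_right (huv : u ≤ v) (lam : Icc u v ≃o Icc u v) {t : Icc u v}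
    (ht : (t : ℝ) = v) : (lam t : ℝ) = v := by
  have h : lam.symm ⟨v, right_mem_Icc.2 huv⟩ ≤ t := by
    change _ ≤ (t : ℝ)
    rw [ht]; exact (lam.symm _).2.2
  have h2 := lam.monotone h
  rw [OrderIso.apply_symm_apply] at h2
  exact le_antisymm (lam t).2.2 h2

/-- A time change is close to the identity if it is small. -/
theorem abs_orderIso_sub_le {lam : Icc u v ≃o Icc u v} {c : ℝ} (hc : 0 ≤ c)
    (h : warpSize lam ≤ ENNReal.ofReal c) (t : Icc u v) :
    |(lam t : ℝ) - t| ≤ (Real.exp c - 1) * (v - u) := by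
  have huv : u ≤ v := t.2.1.trans t.2.2
  have h1 := (warpSize_le_ofReal_iff hc).1 h ⟨u, left_mem_Icc.2 huv⟩ t t.2.1
  rw [coe_orderIso_left huv lam (t := ⟨u, left_mem_Icc.2 huv⟩) rfl] at h1
  simp only at h1
  have hexp : 1 - c ≤ Real.exp (-c) := by have := Real.add_one_le_exp (-c); linarith
  have hexp' : c ≤ Real.exp c - 1 := by have := Real.add_one_le_exp c; linarith
  have hA : (Real.exp c - 1) * (t - u) ≤ (Real.exp c - 1) * (v - u) :=
    mul_le_mul_of_nonneg_left (by linarith [t.2.2]) (hc.trans hexp')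
  have hB : (1 - Real.exp (-c)) * (t - u) ≤ (Real.exp c - 1) * (t - u) :=
    mul_le_mul_of_nonneg_right (by linarith) (sub_nonneg.2 t.2.1)
  rw [abs_le]
  constructor <;> nlinarith [h1.1, h1.2]

/-- A map of `[u, v]` that fixes the endpoints and has its difference quotients in
`[exp (-c), exp c]` is a time change of size at most `c`. -/
theorem exists_orderIso_of_bounds (huv : u ≤ v) {c : ℝ} (hc : 0 ≤ c) (F : Icc u v → ℝ)
    (hu : F ⟨u, left_mem_Icc.2 huv⟩ = u) (hv : F ⟨v, right_mem_Icc.2 huv⟩ = v)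
    (hF : ∀ s t : Icc u v, s ≤ t → Real.exp (-c) * ((t : ℝ) - s) ≤ F t - F s ∧
        F t - F s ≤ Real.exp c * ((t : ℝ) - s)) :
    ∃ lam : Icc u v ≃o Icc u v, (∀ t, (lam t : ℝ) = F t) ∧ warpSize lam ≤ ENNReal.ofReal c := by
  have hmono : StrictMono F := fun s t hst => by
    have := (hF s t hst.le).1
    have h2 := mul_pos (Real.exp_pos (-c)) (sub_pos.2 (show (s : ℝ) < t from hst))
    linarith
  have hmem : ∀ t, F t ∈ Icc u v := fun t =>
    ⟨hu.symm.le.trans (hmono.monotone t.2.1), (hmono.monotone t.2.2).trans hv.le⟩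
  have hcont : Continuous F := by
    refine LipschitzWith.continuous (K := (Real.exp c).toNNReal)
      (LipschitzWith.of_dist_le_mul fun s t => ?_)
    rw [Real.coe_toNNReal _ (Real.exp_pos c).le, Real.dist_eq, Subtype.dist_eq, Real.dist_eq]
    rcases le_total s t with h | h
    · rw [abs_sub_comm, abs_sub_comm (s : ℝ), abs_of_nonneg (sub_nonneg.2 (hmono.monotone h)),
        abs_of_nonneg (sub_nonneg.2 (show (s : ℝ) ≤ t from h))]
      exact (hF s t h).2
    · rw [abs_of_nonneg (sub_nonneg.2 (hmono.monotone h)),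
        abs_of_nonneg (sub_nonneg.2 (show (t : ℝ) ≤ s from h))]
      exact (hF t s h).2
  let G : Icc u v → Icc u v := fun t => ⟨F t, hmem t⟩
  have hG : StrictMono G := fun s t hst => hmono hst
  have hsurj : Function.Surjective G := by
    intro y
    have : PreconnectedSpace (Icc u v) := Subtype.preconnectedSpace isPreconnected_Icc
    obtain ⟨t, ht⟩ := mem_range_of_exists_le_of_exists_ge hcont
      ⟨⟨u, left_mem_Icc.2 huv⟩, hu.le.trans y.2.1⟩ ⟨⟨v, right_mem_Icc.2 huv⟩, y.2.2.trans hv.ge⟩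
    exact ⟨t, Subtype.ext ht⟩
  refine ⟨StrictMono.orderIsoOfSurjective G hG hsurj, fun t => rfl, ?_⟩
  exact (warpSize_le_ofReal_iff hc).2 fun s t hst => hF s t hst

/-- A bound on sizes passes to pointwise limits of time changes. -/
theorem exists_orderIso_of_tendsto (huv : u ≤ v) {c : ℝ} (hc : 0 ≤ c)
    {tau : ℕ → Icc u v ≃o Icc u v} {F : Icc u v → ℝ}
    (hlim : ∀ t, Tendsto (fun m => (tau m t : ℝ)) atTop (𝓝 (F t)))
    (hsize : ∀ᶠ m in atTop, warpSize (tau m) ≤ ENNReal.ofReal c) :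
    ∃ lam : Icc u v ≃o Icc u v, (∀ t, (lam t : ℝ) = F t) ∧ warpSize lam ≤ ENNReal.ofReal c := by
  refine exists_orderIso_of_bounds huv hc F ?_ ?_ fun s t hst => ⟨?_, ?_⟩
  · refine tendsto_nhds_unique (hlim _) (tendsto_const_nhds.congr fun m => ?_)
    exact (coe_orderIso_left huv _ rfl).symm
  · refine tendsto_nhds_unique (hlim _) (tendsto_const_nhds.congr fun m => ?_)
    exact (coe_orderIso_right huv _ rfl).symm
  · exact ge_of_tendsto ((hlim t).sub (hlim s))
      (hsize.mono fun m hm => ((warpSize_le_ofReal_iff hc).1 hm s t hst).1)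
  · exact le_of_tendsto ((hlim t).sub (hlim s))
      (hsize.mono fun m hm => ((warpSize_le_ofReal_iff hc).1 hm s t hst).2)

theorem warpSize_mul_inv_le_geometric {sig : ℕ → Icc u v ≃o Icc u v}
    (h : ∀ n, warpSize (sig (n + 1) * (sig n)⁻¹) ≤ ENNReal.ofReal ((1 / 2) ^ n)) (n k : ℕ) :
    warpSize (sig (n + k) * (sig n)⁻¹) ≤ ENNReal.ofReal (2 * (1 / 2) ^ n) := by
  have : warpSize (sig (n + k) * (sig n)⁻¹) ≤
      ENNReal.ofReal (2 * (1 / 2) ^ n - 2 * (1 / 2) ^ (n + k)) := by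
    induction k with
    | zero => simp
    | succ k ih =>
      have hmul : sig (n + (k + 1)) * (sig n)⁻¹ =
          (sig (n + k + 1) * (sig (n + k))⁻¹) * (sig (n + k) * (sig n)⁻¹) := by
        rw [← add_assoc]; group
      rw [hmul]
      refine (warpSize_mul_le _ _).trans ((add_le_add (h _) ih).trans ?_)
      have h1 : ((1 : ℝ) / 2) ^ (n + k) ≤ (1 / 2) ^ n :=
        pow_le_pow_of_le_one (by norm_num) (by norm_num) (by omega)
      rw [← ENNReal.ofReal_add (by positivity) (by linarith)]
      refine ENNReal.ofReal_le_ofReal (le_of_eq ?_)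
      rw [← add_assoc, pow_succ]; ring
  refine this.trans (ENNReal.ofReal_le_ofReal ?_)
  have : (0 : ℝ) ≤ (1 / 2) ^ (n + k) := by positivity
  linarith

/-- The group of time changes is complete: a sequence whose increments have summable size
converges to a time change. -/
theorem exists_orderIso_limit (huv : u ≤ v) {sig : ℕ → Icc u v ≃o Icc u v}
    (h : ∀ n, warpSize (sig (n + 1) * (sig n)⁻¹) ≤ ENNReal.ofReal ((1 / 2) ^ n)) :
    ∃ lam : Icc u v ≃o Icc u v,
      ∀ n, warpSize (sig n * lam⁻¹) ≤ ENNReal.ofReal (2 * (1 / 2) ^ n) := by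
  have hgeo := warpSize_mul_inv_le_geometric h
  have hsmall : Tendsto (fun n : ℕ => (Real.exp (2 * (1 / 2) ^ n) - 1) * (v - u)) atTop (𝓝 0) := by
    have h1 : Tendsto (fun n : ℕ => 2 * ((1 : ℝ) / 2) ^ n) atTop (𝓝 0) := by
      simpa using (tendsto_pow_atTop_nhds_zero_of_lt_one (r := (1 : ℝ) / 2) (by norm_num)
        (by norm_num)).const_mul 2
    have h2 := (((Real.continuous_exp.tendsto 0).comp h1).sub_const 1).mul_const (v - u)
    simpa using h2
  have hcauchy : ∀ t, CauchySeq fun n => (sig n t : ℝ) := fun t => by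
    refine cauchySeq_of_le_tendsto_0' _ (fun n m hnm => ?_) hsmall
    obtain ⟨k, rfl⟩ := Nat.exists_eq_add_of_le hnm
    have := abs_orderIso_sub_le (by positivity) (hgeo n k) (sig n t)
    rw [RelIso.mul_apply, RelIso.inv_apply_self] at this
    rwa [dist_comm, Real.dist_eq]
  choose F hF using fun t => cauchySeq_tendsto_of_complete (hcauchy t)
  have hlim : ∀ n t, Tendsto (fun m => (((sig m * (sig n)⁻¹) t : Icc u v) : ℝ)) atTop
      (𝓝 (F ((sig n)⁻¹ t))) := fun n t => hF _
  have hev : ∀ n, ∀ᶠ m in atTop, warpSize (sig m * (sig n)⁻¹) ≤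
      ENNReal.ofReal (2 * (1 / 2) ^ n) := fun n => by
    filter_upwards [eventually_ge_atTop n] with m hm
    obtain ⟨k, rfl⟩ := Nat.exists_eq_add_of_le hm
    exact hgeo n k
  choose rho hrho hrho' using fun n =>
    exists_orderIso_of_tendsto huv (by positivity) (hlim n) (hev n)
  refine ⟨rho 0 * sig 0, fun n => ?_⟩
  have : sig n * (rho 0 * sig 0)⁻¹ = (rho n)⁻¹ := by
    have h3 : rho 0 * sig 0 = rho n * sig n := by
      ext t
      rw [RelIso.mul_apply, RelIso.mul_apply, hrho, hrho, RelIso.inv_apply_self,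
        RelIso.inv_apply_self]
    rw [h3]; group
  rw [this, warpSize_inv]
  exact hrho' n

/-- Finitely many interior points can be moved to rational points by an arbitrarily small time
change. -/
theorem exists_orderIso_rat (huv : u < v) (S : Finset (Icc u v))
    (hS : ∀ s ∈ S, u < (s : ℝ) ∧ (s : ℝ) < v) {c : ℝ} (hc : 0 < c) :
    ∃ lam : Icc u v ≃o Icc u v, warpSize lam ≤ ENNReal.ofReal c ∧
      ∀ s ∈ S, ∃ q : ℚ, (lam s : ℝ) = q := by
  classical
  set L : Icc u v := ⟨u, left_mem_Icc.2 huv.le⟩ with hL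
  set R : Icc u v := ⟨v, right_mem_Icc.2 huv.le⟩ with hR
  set S' : Finset (Icc u v) := insert L (insert R S) with hS'
  -- `eta` is a lower bound for the distances between distinct points of `S'`.
  obtain ⟨eta, heta, hgap⟩ : ∃ eta : ℝ, 0 < eta ∧ ∀ p ∈ S', ∀ q ∈ S', p ≠ q → eta ≤ dist p q := by
    have hnt : (S' : Set (Icc u v)).Nontrivial :=
      ⟨L, by simp [hS'], R, by simp [hS'], fun h => huv.ne (congrArg Subtype.val h)⟩
    exact ⟨_, (S'.finite_toSet.infsep_pos_iff_nontrivial).2 hnt, fun p hp q hq hpq =>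
      Set.infsep_le_dist_of_mem (Finset.mem_coe.2 hp) (Finset.mem_coe.2 hq) hpq⟩
  set kap : ℝ := 1 - Real.exp (-c) with hkap
  have hkpos : 0 < kap := by
    have : Real.exp (-c) < 1 := by rw [← Real.exp_zero]; exact Real.exp_lt_exp.2 (by linarith)
    linarith
  choose q hq1 hq2 using fun s : Icc u v =>
    exists_rat_btwn (show (s : ℝ) < s + kap * eta / 2 by have := mul_pos hkpos heta; linarith)
  let phi : Icc u v → ℝ := fun s => if s ∈ S then (q s : ℝ) - s else 0
  have hphi : ∀ s, |phi s| ≤ kap * eta / 2 := fun s => by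
    by_cases hs : s ∈ S
    · simp only [phi, hs, if_true]
      rw [abs_of_pos (sub_pos.2 (hq1 s))]
      linarith [hq2 s]
    · simp only [phi, hs, if_false, abs_zero]
      positivity
  have hLip : LipschitzOnWith kap.toNNReal phi (S' : Set (Icc u v)) := by
    refine LipschitzOnWith.of_dist_le_mul fun x hx y hy => ?_
    rw [Real.coe_toNNReal _ hkpos.le]
    by_cases hxy : x = y
    · simp [hxy]
    · have h1 := hgap x (Finset.mem_coe.1 hx) y (Finset.mem_coe.1 hy) hxy
      calc dist (phi x) (phi y) ≤ |phi x| + |phi y| := abs_sub _ _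
        _ ≤ kap * eta := by linarith [hphi x, hphi y]
        _ ≤ kap * dist x y := mul_le_mul_of_nonneg_left h1 hkpos.le
  obtain ⟨g, hg, hgS⟩ := hLip.extend_real
  have hLS : L ∉ S := fun h => lt_irrefl _ (hS L h).1
  have hRS : R ∉ S := fun h => lt_irrefl _ (hS R h).2
  have hgL : g L = 0 := by
    rw [← hgS (by simp [hS'])]; simp [phi, hLS]
  have hgR : g R = 0 := by
    rw [← hgS (by simp [hS'])]; simp [phi, hRS]
  obtain ⟨lam, hlam, hsize⟩ := exists_orderIso_of_bounds huv.le hc.le (fun t => (t : ℝ) + g t)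
    (by rw [← hL, hgL]; simp [hL]) (by rw [← hR, hgR]; simp [hR]) (fun s t hst => by
      have h1 := hg.dist_le_mul t s
      rw [Real.coe_toNNReal _ hkpos.le, Real.dist_eq, Subtype.dist_eq, Real.dist_eq,
        abs_of_nonneg (sub_nonneg.2 (show (s : ℝ) ≤ t from hst)), abs_le] at h1
      -- The slopes lie in `[1 - kap, 1 + kap]`, and `2 - exp (-c) ≤ exp c`.
      have h2 : 2 - Real.exp (-c) ≤ Real.exp c := by
        have := Real.add_one_le_exp c
        have h3 : Real.exp (-c) * Real.exp c = 1 := by rw [← Real.exp_add]; simp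
        nlinarith [sq_nonneg (Real.exp c - 1), Real.exp_pos (-c), Real.exp_pos c]
      have h3 : (0 : ℝ) ≤ t - s := sub_nonneg.2 hst
      constructor
      · rw [hkap] at h1
        nlinarith [h1.1]
      · have := mul_le_mul_of_nonneg_right h2 h3
        rw [hkap] at h1
        nlinarith [h1.2])
  refine ⟨lam, hsize, fun s hs => ⟨q s, ?_⟩⟩
  rw [hlam, ← hgS (by simp [hS', hs])]
  simp [phi, hs]

end Warps

/-! ### Distances modulo a group of time changes -/

section WarpDist

variable {G X : Type*}

/-- The uniform distance of `f` to the orbit of `g` under a set `G` of transformations of `X`,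
penalized by the size `N` of the transformation. Both `dK` and `dKTilde` are of this form. -/
noncomputable def warpDist (N : G → ℝ≥0∞) (act : G → X → X) (f g : X → ℝ) : ℝ≥0∞ :=
  ⨅ lam : G, N lam + ⨆ x, ENNReal.ofReal |f x - g (act lam x)|

variable {N : G → ℝ≥0∞} {act : G → X → X}

theorem warpDist_le (lam : G) (f g : X → ℝ) :
    warpDist N act f g ≤ N lam + ⨆ x, ENNReal.ofReal |f x - g (act lam x)| :=
  iInf_le _ lam

/-- Two functions are close iff a small transformation makes them uniformly close. -/
theorem exists_of_warpDist_lt {f g : X → ℝ} {r : ℝ} (h : warpDist N act f g < ENNReal.ofReal r) :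
    ∃ lam, N lam ≤ ENNReal.ofReal r ∧ ∀ x, |f x - g (act lam x)| < r := by
  obtain ⟨lam, hlam⟩ := iInf_lt_iff.1 h
  refine ⟨lam, le_self_add.trans hlam.le, fun x => ?_⟩
  have hx : ENNReal.ofReal |f x - g (act lam x)| < ENNReal.ofReal r :=
    ((le_iSup (fun x => ENNReal.ofReal |f x - g (act lam x)|) x).trans le_add_self).trans_lt hlam
  exact (ENNReal.ofReal_lt_ofReal_iff_of_nonneg (abs_nonneg _)).1 hx

theorem warpDist_le_of_forall {f g : X → ℝ} {c e : ℝ} (hc : 0 ≤ c) (he : 0 ≤ e) (lam : G)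
    (h1 : N lam ≤ ENNReal.ofReal c) (h2 : ∀ x, |f x - g (act lam x)| ≤ e) :
    warpDist N act f g ≤ ENNReal.ofReal (c + e) := by
  rw [ENNReal.ofReal_add hc he]
  exact (warpDist_le lam f g).trans
    (add_le_add h1 (iSup_le fun x => ENNReal.ofReal_le_ofReal (h2 x)))

variable [Group G]

theorem warpDist_le_supDist (h1 : N 1 = 0) (act1 : ∀ x, act 1 x = x) (f g : X → ℝ) :
    warpDist N act f g ≤ ⨆ x, ENNReal.ofReal |f x - g x| := by
  simpa [h1, act1] using warpDist_le (N := N) (act := act) 1 f g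

theorem warpDist_self (h1 : N 1 = 0) (act1 : ∀ x, act 1 x = x) (f : X → ℝ) :
    warpDist N act f f = 0 :=
  le_antisymm (by simpa using warpDist_le_supDist h1 act1 f f) bot_le

theorem warpDist_comm (act1 : ∀ x, act 1 x = x) (hinv : ∀ lam, N lam⁻¹ = N lam)
    (actm : ∀ lam mu x, act (lam * mu) x = act lam (act mu x)) (f g : X → ℝ) :
    warpDist N act f g = warpDist N act g f := by
  have key : ∀ f g : X → ℝ, warpDist N act f g ≤ warpDist N act g f := fun f g => by
    refine le_iInf fun lam => (warpDist_le lam⁻¹ f g).trans ?_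
    rw [hinv]
    refine add_le_add le_rfl (iSup_le fun x => ?_)
    have := le_iSup (fun x => ENNReal.ofReal |g x - f (act lam x)|) (act lam⁻¹ x)
    rwa [← actm, mul_inv_cancel, act1, abs_sub_comm] at this
  exact le_antisymm (key f g) (key g f)

theorem warpDist_triangle (hmul : ∀ lam mu, N (lam * mu) ≤ N lam + N mu)
    (actm : ∀ lam mu x, act (lam * mu) x = act lam (act mu x)) (f g h : X → ℝ) :
    warpDist N act f h ≤ warpDist N act f g + warpDist N act g h := by
  conv_rhs => rw [warpDist, warpDist, ENNReal.iInf_add]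
  refine le_iInf fun lam => ?_
  rw [ENNReal.add_iInf]
  refine le_iInf fun mu => (warpDist_le (mu * lam) f h).trans ?_
  rw [add_add_add_comm, add_comm (N lam)]
  refine add_le_add (hmul _ _) (iSup_le fun x => ?_)
  rw [actm, ← sub_add_sub_cancel _ (g (act lam x))]
  refine (ENNReal.ofReal_le_ofReal (abs_add_le _ _)).trans (ENNReal.ofReal_add_le.trans ?_)
  exact add_le_add (le_iSup (fun x => ENNReal.ofReal |f x - g (act lam x)|) x)
    (le_iSup (fun x => ENNReal.ofReal |g x - h (act mu x)|) (act lam x))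

end WarpDist

section Distances

variable {n : ℕ} {a b : Fin (n + 1) → ℝ}

/-- The group of all products of time changes. -/
abbrev Warps (a b : Fin (n + 1) → ℝ) : Type :=
  ∀ k : Fin (n + 1), Icc (a k) (b k) ≃o Icc (a k) (b k)

/-- The coordinatewise action of a product of time changes on the rectangle. -/
def warpAct (lam : Warps a b) (x : Rect a b) : Rect a b := fun k => lam k (x k)

/-- The size of a product of time changes. -/
noncomputable def warpsSize (lam : Warps a b) : ℝ≥0∞ := ⨆ k, warpSize (lam k)

/-- The product of time changes that acts on the first coordinate only. -/
def firstWarp (lam : Rect₁ a b ≃o Rect₁ a b) : Warps a b :=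
  Fin.cons (α := fun k : Fin (n + 1) => Icc (a k) (b k) ≃o Icc (a k) (b k)) lam fun _ => 1

@[simp] theorem pt_zero (t : Rect₁ a b) (ξ : Rect₂ a b) : pt t ξ 0 = t := rfl

@[simp] theorem pt_succ (t : Rect₁ a b) (ξ : Rect₂ a b) (k : Fin n) : pt t ξ k.succ = ξ k := rfl

theorem pt_eta (x : Rect a b) : pt (x 0) (fun k => x k.succ) = x :=
  Fin.cons_self_tail (α := fun k : Fin (n + 1) => Icc (a k) (b k)) x

theorem warpAct_pt (lam : Warps a b) (t : Rect₁ a b) (ξ : Rect₂ a b) :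
    warpAct lam (pt t ξ) = pt (lam 0 t) fun k => lam k.succ (ξ k) := by
  funext k
  refine Fin.cases rfl (fun k => rfl) k

theorem warpAct_firstWarp (lam : Rect₁ a b ≃o Rect₁ a b) (t : Rect₁ a b) (ξ : Rect₂ a b) :
    warpAct (firstWarp lam) (pt t ξ) = pt (lam t) ξ := by
  funext k
  refine Fin.cases rfl (fun k => rfl) k

@[simp] theorem warpAct_one (x : Rect a b) : warpAct 1 x = x := rfl

theorem warpAct_mul (lam mu : Warps a b) (x : Rect a b) :
    warpAct (lam * mu) x = warpAct lam (warpAct mu x) := rfl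

@[simp] theorem warpAct_self_inv (lam : Warps a b) (x : Rect a b) :
    warpAct lam (warpAct lam⁻¹ x) = x := by
  rw [← warpAct_mul, mul_inv_cancel, warpAct_one]

theorem warpSize_le_warpsSize (lam : Warps a b) (k) : warpSize (lam k) ≤ warpsSize lam :=
  le_iSup (fun k => warpSize (lam k)) k

theorem warpsSize_le_iff {lam : Warps a b} {C : ℝ≥0∞} :
    warpsSize lam ≤ C ↔ ∀ k, warpSize (lam k) ≤ C := iSup_le_iff

@[simp] theorem warpsSize_one : warpsSize (1 : Warps a b) = 0 := by
  simp [warpsSize]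

@[simp] theorem warpsSize_inv (lam : Warps a b) : warpsSize lam⁻¹ = warpsSize lam := by
  simp [warpsSize]

theorem warpsSize_mul_le (lam mu : Warps a b) :
    warpsSize (lam * mu) ≤ warpsSize lam + warpsSize mu :=
  iSup_le fun k => (warpSize_mul_le _ _).trans
    (add_le_add (warpSize_le_warpsSize lam k) (warpSize_le_warpsSize mu k))

theorem warpsSize_firstWarp_le (lam : Rect₁ a b ≃o Rect₁ a b) :
    warpsSize (firstWarp lam) ≤ warpSize lam := by
  refine iSup_le fun k => ?_
  refine Fin.cases le_rfl (fun k => ?_) k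
  exact (warpSize_one (u := a k.succ) (v := b k.succ)).le.trans bot_le

theorem firstWarp_one : firstWarp (1 : Rect₁ a b ≃o Rect₁ a b) = 1 := by
  funext k
  refine Fin.cases rfl (fun k => rfl) k

theorem firstWarp_mul (lam mu : Rect₁ a b ≃o Rect₁ a b) :
    firstWarp (lam * mu) = firstWarp lam * firstWarp mu := by
  funext k
  refine Fin.cases rfl (fun k => rfl) k

theorem iSup_pt (F : Rect a b → ℝ≥0∞) :
    (⨆ (t : Rect₁ a b) (ξ : Rect₂ a b), F (pt t ξ)) = ⨆ x, F x :=
  le_antisymm (iSup₂_le fun t ξ => le_iSup F _) (iSup_le fun x => by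
    conv_lhs => rw [← pt_eta x]
    exact le_iSup₂ (f := fun (t : Rect₁ a b) (ξ : Rect₂ a b) => F (pt t ξ)) _ _)

theorem dKTilde_eq_warpDist (f g : Rect a b → ℝ) :
    dKTilde f g = warpDist warpSize (fun lam => warpAct (firstWarp lam)) f g := by
  refine iInf_congr fun lam => ?_
  rw [← iSup_pt]
  simp only [warpAct_firstWarp]

theorem supDist_eq (f g : Rect a b → ℝ) : supDist f g = ⨆ x, ENNReal.ofReal |f x - g x| := rfl

theorem dK_le_dKTilde (f g : Rect a b → ℝ) : dK f g ≤ dKTilde f g := by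
  rw [dKTilde_eq_warpDist]
  exact le_iInf fun lam => (warpDist_le (firstWarp lam) f g).trans
    (add_le_add (warpsSize_firstWarp_le lam) le_rfl)

theorem firstWarp_act_one (x : Rect a b) :
    warpAct (firstWarp (1 : Rect₁ a b ≃o Rect₁ a b)) x = x := by
  rw [firstWarp_one, warpAct_one]

theorem firstWarp_act_mul (lam mu : Rect₁ a b ≃o Rect₁ a b) (x : Rect a b) :
    warpAct (firstWarp (lam * mu)) x = warpAct (firstWarp lam) (warpAct (firstWarp mu) x) := by
  rw [firstWarp_mul, warpAct_mul]

theorem dKTilde_le_supDist (f g : Rect a b → ℝ) : dKTilde f g ≤ supDist f g := by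
  rw [dKTilde_eq_warpDist]
  exact warpDist_le_supDist warpSize_one firstWarp_act_one f g

theorem dK_self (f : Rect a b → ℝ) : dK f f = 0 :=
  warpDist_self warpsSize_one warpAct_one f

theorem dK_comm (f g : Rect a b → ℝ) : dK f g = dK g f :=
  warpDist_comm warpAct_one warpsSize_inv warpAct_mul f g

theorem dK_triangle (f g h : Rect a b → ℝ) : dK f h ≤ dK f g + dK g h :=
  warpDist_triangle warpsSize_mul_le warpAct_mul f g h

theorem dKTilde_comm (f g : Rect a b → ℝ) : dKTilde f g = dKTilde g f := by
  simp only [dKTilde_eq_warpDist]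
  exact warpDist_comm firstWarp_act_one warpSize_inv firstWarp_act_mul f g

theorem dKTilde_triangle (f g h : Rect a b → ℝ) : dKTilde f h ≤ dKTilde f g + dKTilde g h := by
  simp only [dKTilde_eq_warpDist]
  exact warpDist_triangle warpSize_mul_le firstWarp_act_mul f g h

theorem supDist_self (f : Rect a b → ℝ) : supDist f f = 0 := by simp [supDist_eq]

theorem supDist_comm (f g : Rect a b → ℝ) : supDist f g = supDist g f := by
  simp only [supDist_eq, abs_sub_comm]

theorem supDist_triangle (f g h : Rect a b → ℝ) : supDist f h ≤ supDist f g + supDist g h := by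
  simp only [supDist_eq]
  refine iSup_le fun x => ?_
  rw [← sub_add_sub_cancel _ (g x)]
  refine (ENNReal.ofReal_le_ofReal (abs_add_le _ _)).trans (ENNReal.ofReal_add_le.trans ?_)
  exact add_le_add (le_iSup (fun x => ENNReal.ofReal |f x - g x|) x)
    (le_iSup (fun x => ENNReal.ofReal |g x - h x|) x)

theorem dKTilde_self (f : Rect a b → ℝ) : dKTilde f f = 0 :=
  le_antisymm ((dKTilde_le_supDist f f).trans (supDist_self f).le) bot_le

theorem exists_of_dK_lt {f g : Rect a b → ℝ} {r : ℝ} (h : dK f g < ENNReal.ofReal r) :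
    ∃ lam : Warps a b, warpsSize lam ≤ ENNReal.ofReal r ∧ ∀ x, |f x - g (warpAct lam x)| < r :=
  exists_of_warpDist_lt h

theorem dK_le_of_forall {f g : Rect a b → ℝ} {c e : ℝ} (hc : 0 ≤ c) (he : 0 ≤ e) (lam : Warps a b)
    (h1 : warpsSize lam ≤ ENNReal.ofReal c) (h2 : ∀ x, |f x - g (warpAct lam x)| ≤ e) :
    dK f g ≤ ENNReal.ofReal (c + e) :=
  warpDist_le_of_forall hc he lam h1 h2

theorem exists_of_dKTilde_lt {f g : Rect a b → ℝ} {r : ℝ} (h : dKTilde f g < ENNReal.ofReal r) :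
    ∃ lam : Rect₁ a b ≃o Rect₁ a b, warpSize lam ≤ ENNReal.ofReal r ∧
      ∀ t ξ, |f (pt t ξ) - g (pt (lam t) ξ)| < r := by
  rw [dKTilde_eq_warpDist] at h
  obtain ⟨lam, h1, h2⟩ := exists_of_warpDist_lt h
  exact ⟨lam, h1, fun t ξ => by simpa only [warpAct_firstWarp] using h2 (pt t ξ)⟩

theorem dKTilde_le_of_forall {f g : Rect a b → ℝ} {c e : ℝ} (hc : 0 ≤ c) (he : 0 ≤ e)
    (lam : Rect₁ a b ≃o Rect₁ a b) (h1 : warpSize lam ≤ ENNReal.ofReal c)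
    (h2 : ∀ t ξ, |f (pt t ξ) - g (pt (lam t) ξ)| ≤ e) :
    dKTilde f g ≤ ENNReal.ofReal (c + e) := by
  rw [dKTilde_eq_warpDist]
  refine warpDist_le_of_forall hc he lam h1 fun x => ?_
  rw [← pt_eta x, warpAct_firstWarp]
  exact h2 _ _

/-- A radius below which products of time changes move points by less than `δ`. -/
theorem exists_pos_forall_dist_warpAct_lt (a b : Fin (n + 1) → ℝ) {δ : ℝ} (hδ : 0 < δ) :
    ∃ c : ℝ, 0 < c ∧ ∀ lam : Warps a b, warpsSize lam ≤ ENNReal.ofReal c →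
      ∀ x, dist (warpAct lam x) x < δ := by
  have h1 : ∀ᶠ c : ℝ in 𝓝[>] 0, ∀ k, (Real.exp c - 1) * (b k - a k) < δ := by
    refine eventually_all.2 fun k => ?_
    have h2 : Tendsto (fun c : ℝ => (Real.exp c - 1) * (b k - a k)) (𝓝 0) (𝓝 0) := by
      have := (Real.continuous_exp.sub continuous_const).mul
        (continuous_const (y := b k - a k)) |>.tendsto (X := ℝ) (f := fun c : ℝ =>
          (Real.exp c - 1) * (b k - a k)) 0
      simpa using this
    exact (h2.eventually_lt_const hδ).filter_mono nhdsWithin_le_nhds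
  obtain ⟨c, hc, hc0⟩ := (h1.and self_mem_nhdsWithin).exists
  have hc0 : 0 < c := hc0
  refine ⟨c, hc0, fun lam hlam x => (dist_pi_lt_iff hδ).2 fun k => ?_⟩
  rw [Subtype.dist_eq, Real.dist_eq]
  have hk := (warpSize_le_warpsSize lam k).trans hlam
  exact (abs_orderIso_sub_le hc0.le hk (x k)).trans_lt (hc k)

end Distances

/-! ### Topologies generated by metrics -/

section Topologies

theorem exists_pos_ofReal_le {ε : ℝ≥0∞} (hε : 0 < ε) : ∃ r : ℝ, 0 < r ∧ ENNReal.ofReal r ≤ ε := by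
  refine ⟨(min ε 1).toReal, ENNReal.toReal_pos (lt_min hε one_pos).ne'
    ((min_le_right _ _).trans_lt ENNReal.one_lt_top).ne, ?_⟩
  exact ENNReal.ofReal_toReal_le.trans (min_le_left _ _)

variable {X : Type*} {S : Set X} {d d' : X → X → ℝ≥0∞}

/-- The extended metric space given by a metric on `S`. -/
@[reducible] noncomputable def IsMetricOn.toEMetricSpace (h : IsMetricOn S d) : EMetricSpace S where
  edist f g := d f g
  edist_self f := (h.eq_zero_iff f f.2 f f.2).2 rfl
  edist_comm f g := h.symm f f.2 g g.2
  edist_triangle f g k := h.triangle f f.2 g g.2 k k.2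
  eq_of_edist_eq_zero {f g} hfg := Subtype.ext ((h.eq_zero_iff f f.2 g g.2).1 hfg)

theorem IsMetricOn.topology_eq (h : IsMetricOn S d) :
    h.toEMetricSpace.toUniformSpace.toTopologicalSpace = topologyOn S d := by
  let _ := h.toEMetricSpace
  refine TopologicalSpace.ext_iff.2 fun U => ?_
  rw [EMetric.isOpen_iff]
  constructor
  · intro hU f hf
    obtain ⟨ε, hε, hεU⟩ := hU f hf
    obtain ⟨r, hr0, hr⟩ := exists_pos_ofReal_le hε
    refine ⟨r, hr0, fun g hg => hεU ?_⟩
    rw [Metric.mem_eball, edist_comm]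
    exact hg.2.trans_le hr
  · intro hU f hf
    obtain ⟨r, hr, hrU⟩ := hU f hf
    refine ⟨ENNReal.ofReal r, ENNReal.ofReal_pos.2 hr, fun g hg => hrU g ⟨g.2, ?_⟩⟩
    rw [Metric.mem_eball, edist_comm] at hg
    exact hg

theorem IsMetricOn.mono {T : Set X} (h : IsMetricOn S d) (hT : T ⊆ S) : IsMetricOn T d where
  lt_top f hf g hg := h.lt_top f (hT hf) g (hT hg)
  eq_zero_iff f hf g hg := h.eq_zero_iff f (hT hf) g (hT hg)
  symm f hf g hg := h.symm f (hT hf) g (hT hg)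
  triangle f hf g hg k hk := h.triangle f (hT hf) g (hT hg) k (hT hk)

/-- Two comparable metrics generate the same topology if the balls of the larger one contain
balls of the smaller one. -/
theorem topologyOn_eq {T : Set X} (hT : T ⊆ S) (hle : ∀ f ∈ T, ∀ g ∈ T, d f g ≤ d' f g)
    (hball : ∀ f ∈ T, ∀ r : ℝ, 0 < r → ∃ δ : ℝ, 0 < δ ∧ ballIn S d f δ ⊆ ballIn S d' f r) :
    topologyOn T d = topologyOn T d' := by
  refine TopologicalSpace.ext_iff.2 fun U => ⟨fun hU f hf => ?_, fun hU f hf => ?_⟩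
  · obtain ⟨r, hr, hrU⟩ := hU f hf
    exact ⟨r, hr, fun g hg => hrU g ⟨g.2, (hle f f.2 g g.2).trans_lt hg.2⟩⟩
  · obtain ⟨r, hr, hrU⟩ := hU f hf
    obtain ⟨δ, hδ, hδr⟩ := hball f f.2 r hr
    exact ⟨δ, hδ, fun g hg => hrU g ⟨g.2, (hδr ⟨hT g.2, hg.2⟩).2⟩⟩

/-- For completeness it suffices that fast Cauchy sequences converge. -/
theorem IsMetricOn.polishSpace (h : IsMetricOn S d)
    (hdense : ∀ r : ℝ, 0 < r → ∃ t : Set S, t.Countable ∧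
      ∀ f : S, ∃ g ∈ t, d f g ≤ ENNReal.ofReal r)
    (hcomplete : ∀ u : ℕ → X, (∀ i, u i ∈ S) →
      (∀ i, d (u i) (u (i + 1)) < ENNReal.ofReal ((1 / 2) ^ i)) →
      ∃ f ∈ S, Tendsto (fun i => d (u i) f) atTop (𝓝 0)) :
    @PolishSpace S (topologyOn S d) := by
  rw [← h.topology_eq]
  let _ := h.toEMetricSpace
  have : SecondCountableTopology S := by
    refine EMetric.secondCountable_of_almost_dense_set fun ε hε => ?_
    obtain ⟨r, hr, hrε⟩ := exists_pos_ofReal_le hε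
    obtain ⟨t, ht, htr⟩ := hdense r hr
    refine ⟨t, ht, eq_univ_of_forall fun f => ?_⟩
    obtain ⟨g, hg, hfg⟩ := htr f
    exact mem_iUnion₂.2 ⟨g, hg, Metric.mem_closedEBall.2 (hfg.trans hrε)⟩
  have : CompleteSpace S := by
    refine EMetric.complete_of_convergent_controlled_sequences
      (fun i => ENNReal.ofReal ((1 / 2) ^ i)) (fun i => ENNReal.ofReal_pos.2 (by positivity))
      fun u hu => ?_
    obtain ⟨f, hf, hlim⟩ := hcomplete (fun i => u i) (fun i => (u i).2)
      (fun i => hu i i (i + 1) le_rfl (Nat.le_succ i))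
    exact ⟨⟨f, hf⟩, tendsto_iff_edist_tendsto_0.2 hlim⟩
  infer_instance

theorem IsMetricOn.isClosed (h : IsMetricOn S d) {T : Set X}
    (hT : ∀ f ∈ S, (∀ ε : ℝ, 0 < ε → ∃ g ∈ T, d f g < ENNReal.ofReal ε) → f ∈ T) :
    IsClosed[topologyOn S d] {f : S | (f : X) ∈ T} := by
  rw [← h.topology_eq]
  let _ := h.toEMetricSpace
  refine isClosed_of_closure_subset fun f hf => hT f f.2 fun ε hε => ?_
  obtain ⟨g, hg, hfg⟩ := EMetric.mem_closure_iff.1 hf (ENNReal.ofReal ε) (ENNReal.ofReal_pos.2 hε)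
  exact ⟨g, hg, hfg⟩

theorem IsMetricOn.polishSpace_of_isClosed (h : IsMetricOn S d) {T : Set X} (hTS : T ⊆ S)
    (hpolish : @PolishSpace S (topologyOn S d))
    (hclosed : IsClosed[topologyOn S d] {f : S | (f : X) ∈ T}) :
    @PolishSpace T (topologyOn T d) := by
  rw [← (h.mono hTS).topology_eq]
  rw [← h.topology_eq] at hclosed hpolish
  let _ := h.toEMetricSpace
  let _ := (h.mono hTS).toEMetricSpace
  have hiso : Isometry (inclusion hTS) := fun f g => rfl
  refine IsClosedEmbedding.polishSpace ⟨hiso.isEmbedding, ?_⟩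
  rwa [range_inclusion]

end Topologies

/-! ### Quadrants -/

section Sides

variable {u v : ℝ}

theorem exists_mem_sideJ (x y : Icc u v) : ∃ s, y ∈ sideJ s x := by
  unfold sideJ
  by_cases hx : (x : ℝ) < v
  · rcases lt_or_ge y x with h | h
    · exact ⟨false, by simpa [hx] using h⟩
    · exact ⟨true, by simpa [hx] using h⟩
  · exact ⟨false, by simp [hx]⟩

/-- The half-open sides of `x` lie in the closure of the open ones; more precisely, a point `y` of
a half-open side of `x` is approached, inside the corresponding open side of `x`, from the side
of `y` whose half-open version contains `y`. -/
theorem neBot_nhdsWithin_sideI (huv : u < v) {x y : Icc u v} {r s : Bool} (hy : y ∈ sideJ s x)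
    (hr : y ∈ sideJ r y) : (𝓝[sideI r y ∩ sideI s x] y).NeBot := by
  have hxv : x ≤ ⟨v, right_mem_Icc.2 huv.le⟩ := x.2.2
  unfold sideJ at hy hr
  by_cases hyv : (y : ℝ) < v
  · have hr' : r = true := by
      cases r
      · simp [hyv] at hr
      · rfl
    have hgt : (𝓝[>] y).NeBot := nhdsGT_neBot_of_exists_gt ⟨⟨v, right_mem_Icc.2 huv.le⟩, hyv⟩
    refine hgt.mono (nhdsWithin_le_of_mem ?_)
    subst hr'
    cases s
    · have hyx : y < x := by
        by_cases hx : (x : ℝ) < v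
        · simpa [hx] using hy
        · exact (show (y : ℝ) < x from hyv.trans_le (not_lt.1 hx))
      simpa [sideI] using inter_mem self_mem_nhdsWithin
        (mem_nhdsWithin_of_mem_nhds (Iio_mem_nhds hyx))
    · have hxy : x ≤ y := by
        by_cases hx : (x : ℝ) < v
        · simpa [hx] using hy
        · simp [hx] at hy
      simp only [sideI, if_true]
      filter_upwards [self_mem_nhdsWithin] with z hz
      exact ⟨hz, hxy.trans_lt hz⟩
  · have hyv' : (y : ℝ) = v := le_antisymm y.2.2 (not_lt.1 hyv)
    have hr' : r = false := by
      cases r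
      · rfl
      · simp [hyv] at hr
    have hlt : (𝓝[<] y).NeBot := nhdsLT_neBot_of_exists_lt
      ⟨⟨u, left_mem_Icc.2 huv.le⟩, show u < (y : ℝ) by rw [hyv']; exact huv⟩
    refine hlt.mono (nhdsWithin_le_of_mem ?_)
    subst hr'
    cases s
    · have hyx : y ≤ x := by
        by_cases hx : (x : ℝ) < v
        · have : y < x := by simpa [hx] using hy
          exact this.le
        · exact hyv'.le.trans (not_lt.1 hx)
      simp only [sideI, Bool.false_eq_true, if_false]
      filter_upwards [self_mem_nhdsWithin] with z hz
      exact ⟨hz, lt_of_lt_of_le hz hyx⟩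
    · have hxy : x < y := by
        by_cases hx : (x : ℝ) < v
        · exact (show (x : ℝ) < y from hx.trans_le hyv'.ge)
        · simp [hx] at hy
      simpa [sideI] using inter_mem self_mem_nhdsWithin
        (mem_nhdsWithin_of_mem_nhds (Ioi_mem_nhds hxy))

theorem isOpen_sideI (s : Bool) (x : Icc u v) : IsOpen (sideI s x) := by
  unfold sideI
  split_ifs
  exacts [isOpen_Ioi, isOpen_Iio]

theorem orderIso_mem_sideI (lam : Icc u v ≃o Icc u v) {s : Bool} {x y : Icc u v}
    (h : y ∈ sideI s x) : lam y ∈ sideI s (lam x) := by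
  cases s <;> simpa [sideI] using h

theorem orderIso_mem_sideJ (huv : u < v) (lam : Icc u v ≃o Icc u v) {s : Bool} {x y : Icc u v}
    (h : y ∈ sideJ s x) : lam y ∈ sideJ s (lam x) := by
  have hiff : (lam x : ℝ) < v ↔ (x : ℝ) < v := by
    constructor
    · intro h1
      refine lt_of_le_of_ne x.2.2 fun h2 => h1.ne (coe_orderIso_right huv.le lam h2)
    · intro h1
      refine lt_of_le_of_ne (lam x).2.2 fun h2 => h1.ne ?_
      simpa using coe_orderIso_right huv.le lam.symm h2
  unfold sideJ at h ⊢
  by_cases hx : (x : ℝ) < v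
  · cases s <;> simpa [hx, hiff] using h
  · cases s <;> simp [hx, hiff] at h ⊢

end Sides

section Space

variable {n : ℕ} {a b : Fin (n + 1) → ℝ}

theorem quadrant_eq_pi (ρ : Fin (n + 1) → Bool) (x : Rect a b) :
    quadrant ρ x = univ.pi fun k => sideI (ρ k) (x k) := by
  ext y; simp [quadrant]

theorem isOpen_quadrant (ρ : Fin (n + 1) → Bool) (x : Rect a b) : IsOpen (quadrant ρ x) := by
  rw [quadrant_eq_pi]
  exact isOpen_set_pi finite_univ fun k _ => isOpen_sideI _ _

theorem exists_mem_quadrant' (x y : Rect a b) : ∃ ρ, y ∈ quadrant' ρ x := by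
  choose ρ hρ using fun k => exists_mem_sideJ (x k) (y k)
  exact ⟨ρ, hρ⟩

theorem neBot_nhdsWithin_quadrant (hab : ∀ k, a k < b k) {x y : Rect a b}
    {ρ σ : Fin (n + 1) → Bool} (hy : y ∈ quadrant' ρ x) (hσ : y ∈ quadrant' σ y) :
    (𝓝[quadrant σ y ∩ quadrant ρ x] y).NeBot := by
  rw [quadrant_eq_pi, quadrant_eq_pi, ← pi_inter_distrib, nhdsWithin_pi_univ_eq]
  exact pi_neBot.2 fun k => neBot_nhdsWithin_sideI (hab k) (hy k) (hσ k)

/-- A function of `𝒟_K` has a limit not only along the open quadrants, but also along the half-open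
quadrants, which partition `K`. -/
theorem exists_tendsto_quadrant' (hab : ∀ k, a k < b k) {f : Rect a b → ℝ} (hf : f ∈ DK a b)
    (ρ : Fin (n + 1) → Bool) (x : Rect a b) : ∃ l, Tendsto f (𝓝[quadrant' ρ x] x) (𝓝 l) := by
  obtain ⟨l, hl⟩ := (hf x).1 ρ
  refine ⟨l, (closed_nhds_basis l).tendsto_right_iff.2 fun C hC => ?_⟩
  obtain ⟨U, hUC, hU, hxU⟩ := eventually_nhds_iff.1
    (eventually_nhdsWithin_iff.1 (hl.eventually_mem hC.1))
  refine eventually_nhdsWithin_iff.2 ((hU.eventually_mem hxU).mono fun y hyU hy => ?_)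
  obtain ⟨σ, hσ⟩ := exists_mem_quadrant' y y
  have hne := neBot_nhdsWithin_quadrant hab hy hσ
  refine hC.2.mem_of_tendsto (((hf y).2 σ hσ).mono_left
    (nhdsWithin_mono y (inter_subset_left (t := quadrant ρ x)))) ?_
  filter_upwards [self_mem_nhdsWithin, mem_nhdsWithin_of_mem_nhds (hU.mem_nhds hyU)] with z hz hzU
  exact hUC z hzU hz.2

theorem exists_ball_oscillation_lt (hab : ∀ k, a k < b k) {f : Rect a b → ℝ} (hf : f ∈ DK a b)
    (x : Rect a b) {ε : ℝ} (hε : 0 < ε) : ∃ δ : ℝ, 0 < δ ∧ ∀ ρ, ∀ y ∈ Metric.ball x δ,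
      ∀ z ∈ Metric.ball x δ, y ∈ quadrant' ρ x → z ∈ quadrant' ρ x → |f y - f z| < ε := by
  choose l hl using fun ρ => exists_tendsto_quadrant' hab hf ρ x
  have h1 : ∀ᶠ y in 𝓝 x, ∀ ρ, y ∈ quadrant' ρ x → |f y - l ρ| < ε / 2 :=
    eventually_all.2 fun ρ => eventually_nhdsWithin_iff.1
      ((hl ρ).eventually (Metric.ball_mem_nhds _ (half_pos hε)))
  obtain ⟨δ, hδ, h⟩ := Metric.eventually_nhds_iff_ball.1 h1
  refine ⟨δ, hδ, fun ρ y hy z hz hyρ hzρ => ?_⟩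
  have h2 := h y hy ρ hyρ
  have h3 := h z hz ρ hzρ
  rw [abs_lt] at *
  constructor <;> linarith [h2.1, h2.2, h3.1, h3.2]

/-! ### Approximation by step functions -/

/-- Two points of an interval that are not separated by the points of a sufficiently fine finite
set are close. -/
theorem exists_finset_forall_dist_lt {u v : ℝ} {δ : ℝ} (hδ : 0 < δ) :
    ∃ S : Finset (Icc u v), ∀ x y : Icc u v, (∀ s ∈ S, u < (s : ℝ) → (s : ℝ) < v →
      (s ≤ x ↔ s ≤ y)) → dist x y < δ := by
  obtain ⟨t, -, ht, hcov⟩ := finite_cover_balls_of_compact (isCompact_univ (X := Icc u v))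
    (half_pos hδ)
  refine ⟨ht.toFinset, fun x y hxy => ?_⟩
  have key : ∀ x y : Icc u v, x ≤ y → (∀ s ∈ ht.toFinset, u < (s : ℝ) → (s : ℝ) < v →
      (s ≤ x ↔ s ≤ y)) → dist x y < δ := by
    intro x y hle hxy
    by_contra hd
    have hle' : (x : ℝ) ≤ y := hle
    rw [not_lt, dist_comm, Subtype.dist_eq, Real.dist_eq, abs_of_nonneg (sub_nonneg.2 hle')] at hd
    -- The point of the net closest to the midpoint would separate `x` and `y`.
    obtain ⟨s, hs, hms⟩ := mem_iUnion₂.1 (hcov (mem_univ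
      (⟨((x : ℝ) + y) / 2, by linarith [x.2.1], by linarith [y.2.2]⟩ : Icc u v)))
    rw [Metric.mem_ball, Subtype.dist_eq, Real.dist_eq, abs_lt] at hms
    simp only at hms
    have h1 : (x : ℝ) < s := by linarith [hms.1, hms.2]
    have h2 : (s : ℝ) < y := by linarith [hms.1, hms.2]
    have h3 := (hxy s (ht.mem_toFinset.2 hs) (x.2.1.trans_lt h1) (h2.trans_le y.2.2)).2 h2.le
    exact absurd h1 (not_lt.2 h3)
  rcases le_total x y with h | h
  · exact key x y h hxy
  · rw [dist_comm]
    exact key y x h fun s hs hu hv => (hxy s hs hu hv).symm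

/-- A function of `𝒟_K` oscillates little on the cells of a suitable finite grid. A cell is
encoded by telling, for each grid point of each coordinate axis, on which side of it the cell lies.
The grid points can be chosen in the open intervals. -/
theorem exists_step_approx (hab : ∀ k, a k < b k) {f : Rect a b → ℝ} (hf : f ∈ DK a b) {ε : ℝ}
    (hε : 0 < ε) : ∃ S : ∀ k, Finset (Icc (a k) (b k)),
      (∀ k, ∀ s ∈ S k, a k < (s : ℝ) ∧ (s : ℝ) < b k) ∧
      ∃ h : (∀ k, S k → Bool) → ℝ, ∀ x : Rect a b, |f x - h fun k s => decide (s.1 ≤ x k)| < ε := by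
  classical
  choose δ hδ hosc using fun x => exists_ball_oscillation_lt hab hf x hε
  obtain ⟨t, -, hcov⟩ := (isCompact_univ (X := Rect a b)).elim_nhds_subcover
    (fun x => Metric.ball x (δ x)) (fun x _ => Metric.ball_mem_nhds x (hδ x))
  obtain ⟨η, hη, hleb⟩ := lebesgue_number_lemma_of_metric (isCompact_univ (X := Rect a b))
    (c := fun i : t => Metric.ball i.1 (δ i.1)) (fun i => Metric.isOpen_ball)
    (fun x hx => by
      obtain ⟨i, hi, hxi⟩ := mem_iUnion₂.1 (hcov hx)
      exact mem_iUnion.2 ⟨⟨i, hi⟩, hxi⟩)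
  choose M hM using fun k => exists_finset_forall_dist_lt (u := a k) (v := b k) hη
  let S : ∀ k, Finset (Icc (a k) (b k)) := fun k =>
    (M k ∪ t.image fun x => x k).filter fun s => a k < (s : ℝ) ∧ (s : ℝ) < b k
  have key : ∀ x y : Rect a b, (∀ k, ∀ s ∈ S k, s ≤ x k ↔ s ≤ y k) → |f x - f y| < ε := by
    intro x y hxy
    obtain ⟨⟨z, hz⟩, hball⟩ := hleb x (mem_univ x)
    have hdist : dist y x < η := (dist_pi_lt_iff hη).2 fun k =>
      hM k (y k) (x k) fun s hs h1 h2 => (hxy k s (by simp [S, hs, h1, h2])).symm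
    obtain ⟨ρ, hρ⟩ := exists_mem_quadrant' z x
    refine hosc z ρ x (hball (Metric.mem_ball_self hη)) y (hball hdist) hρ fun k => ?_
    have hx := hρ k
    unfold sideJ at hx ⊢
    by_cases hzb : (z k : ℝ) < b k
    · have hiff : z k ≤ x k ↔ z k ≤ y k := by
        by_cases hza : a k < (z k : ℝ)
        · refine hxy k _ (Finset.mem_filter.2 ⟨Finset.mem_union_right _ ?_, hza, hzb⟩)
          exact Finset.mem_image_of_mem (fun x : Rect a b => x k) hz
        · have h1 : ∀ w : Icc (a k) (b k), z k ≤ w := fun w =>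
            (not_lt.1 hza).trans w.2.1
          exact iff_of_true (h1 _) (h1 _)
      cases hρk : ρ k
      · simp only [hzb, hρk, if_true, Bool.false_eq_true, if_false, mem_Iio] at hx ⊢
        exact not_le.1 fun h => not_le.2 hx (hiff.2 h)
      · simp only [hzb, hρk, if_true, mem_Ici] at hx ⊢
        exact hiff.1 hx
    · cases hρk : ρ k
      · simp [hzb]
      · simp [hzb, hρk] at hx
  refine ⟨S, fun k s hs => (Finset.mem_filter.1 hs).2, fun c =>
    if h : ∃ x : Rect a b, (fun k (s : S k) => decide (s.1 ≤ x k)) = c then f h.choose else 0,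
    fun x => ?_⟩
  have hex : ∃ y : Rect a b, (fun k (s : S k) => decide (s.1 ≤ y k)) =
      fun k (s : S k) => decide (s.1 ≤ x k) := ⟨x, rfl⟩
  simp only [dif_pos hex]
  refine key _ _ fun k s hs => ?_
  have := congrFun (congrFun hex.choose_spec k) ⟨s, hs⟩
  exact (decide_eq_decide.1 this).symm

theorem exists_forall_abs_le (hab : ∀ k, a k < b k) {f : Rect a b → ℝ} (hf : f ∈ DK a b) :
    ∃ C : ℝ, ∀ x, |f x| ≤ C := by
  obtain ⟨S, -, h, hh⟩ := exists_step_approx hab hf one_pos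
  obtain ⟨C, hC⟩ := (finite_range fun c => |h c|).bddAbove
  refine ⟨C + 1, fun x => ?_⟩
  have h1 := hC (mem_range_self fun k s => decide (s.1 ≤ x k))
  have h2 := abs_sub_abs_le_abs_sub (f x) (h fun k s => decide (s.1 ≤ x k))
  linarith [hh x]

theorem supDist_lt_top (hab : ∀ k, a k < b k) {f g : Rect a b → ℝ} (hf : f ∈ DK a b)
    (hg : g ∈ DK a b) : supDist f g < ∞ := by
  obtain ⟨C, hC⟩ := exists_forall_abs_le hab hf
  obtain ⟨D, hD⟩ := exists_forall_abs_le hab hg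
  refine lt_of_le_of_lt (iSup_le fun x => ?_) (ENNReal.ofReal_lt_top (r := C + D))
  exact ENNReal.ofReal_le_ofReal ((abs_sub _ _).trans (add_le_add (hC x) (hD x)))

/-! ### The metrics separate points -/

/-- Both functions are determined by their values in open quadrants, and points of open quadrants
stay there under small time changes. -/
theorem eq_of_dK_eq_zero (hab : ∀ k, a k < b k) {f g : Rect a b → ℝ} (hf : f ∈ DK a b)
    (hg : g ∈ DK a b) (h : dK f g = 0) : f = g := by
  funext x
  obtain ⟨ρ, hρ⟩ := exists_mem_quadrant' x x
  refine eq_of_forall_dist_le fun ε hε => ?_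
  have hε3 : 0 < ε / 3 := by linarith
  have h1 := ((hf x).2 ρ hρ).eventually (Metric.ball_mem_nhds _ hε3)
  have h2 := ((hg x).2 ρ hρ).eventually (Metric.ball_mem_nhds _ hε3)
  obtain ⟨U, hU, hxU, hUfg⟩ := mem_nhdsWithin.1 (h1.and h2)
  have hne : (𝓝[quadrant ρ x] x).NeBot := by
    simpa using neBot_nhdsWithin_quadrant hab hρ hρ
  obtain ⟨y, hyU, hyQ⟩ := (hne.nonempty_of_mem
    (inter_mem (mem_nhdsWithin_of_mem_nhds (hU.mem_nhds hxU)) self_mem_nhdsWithin))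
  obtain ⟨η, hη, hηU⟩ := Metric.isOpen_iff.1 (hU.inter (isOpen_quadrant ρ x)) y ⟨hyU, hyQ⟩
  obtain ⟨c, hc, hmove⟩ := exists_pos_forall_dist_warpAct_lt a b hη
  obtain ⟨lam, hlam, hfg⟩ := exists_of_dK_lt (f := f) (g := g) (r := min c (ε / 3)) (by
    rw [h]; exact ENNReal.ofReal_pos.2 (lt_min hc hε3))
  have h3 := (hUfg ⟨hyU, hyQ⟩).1
  have h4 := (hUfg (hηU (hmove lam
    (hlam.trans (ENNReal.ofReal_le_ofReal (min_le_left _ _))) y))).2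
  have h5 : dist (f y) (g (warpAct lam y)) < ε / 3 := (hfg y).trans_le (min_le_right _ _)
  calc dist (f x) (g x) ≤ dist (f x) (f y) + dist (f y) (g (warpAct lam y)) +
        dist (g (warpAct lam y)) (g x) := dist_triangle4 _ _ _ _
    _ ≤ ε := by
      rw [dist_comm (f x)]
      have h3' : dist (f y) (f x) < ε / 3 := h3
      have h4' : dist (g (warpAct lam y)) (g x) < ε / 3 := h4
      linarith

theorem isMetricOn_dK (hab : ∀ k, a k < b k) : IsMetricOn (DK a b) dK where
  lt_top f hf g hg := ((dK_le_dKTilde f g).trans (dKTilde_le_supDist f g)).trans_lt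
    (supDist_lt_top hab hf hg)
  eq_zero_iff f hf _ hg := ⟨eq_of_dK_eq_zero hab hf hg, fun h => h ▸ dK_self f⟩
  symm _ _ _ _ := dK_comm _ _
  triangle _ _ _ _ _ _ := dK_triangle _ _ _

theorem isMetricOn_dKTilde (hab : ∀ k, a k < b k) : IsMetricOn (DK a b) dKTilde where
  lt_top f hf g hg := (dKTilde_le_supDist f g).trans_lt (supDist_lt_top hab hf hg)
  eq_zero_iff f hf g hg := ⟨fun h => eq_of_dK_eq_zero hab hf hg
    (le_antisymm ((dK_le_dKTilde f g).trans h.le) bot_le), fun h => h ▸ dKTilde_self f⟩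
  symm _ _ _ _ := dKTilde_comm _ _
  triangle _ _ _ _ _ _ := dKTilde_triangle _ _ _

theorem isMetricOn_supDist (hab : ∀ k, a k < b k) : IsMetricOn (DK a b) supDist where
  lt_top _ hf _ hg := supDist_lt_top hab hf hg
  eq_zero_iff f hf g hg := ⟨fun h => eq_of_dK_eq_zero hab hf hg
    (le_antisymm (((dK_le_dKTilde f g).trans (dKTilde_le_supDist f g)).trans h.le) bot_le),
    fun h => h ▸ supDist_self f⟩
  symm _ _ _ _ := supDist_comm _ _
  triangle _ _ _ _ _ _ := supDist_triangle _ _ _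

/-! ### Stability of the function spaces under time changes and uniform limits -/

theorem exists_tendsto_of_uniform_approx {X : Type*} {F : Filter X} {f : X → ℝ}
    (h : ∀ ε > 0, ∃ g : X → ℝ, (∃ l, Tendsto g F (𝓝 l)) ∧ ∀ x, |f x - g x| ≤ ε) :
    ∃ l, Tendsto f F (𝓝 l) := by
  rcases F.eq_or_neBot with rfl | hF
  · exact ⟨0, tendsto_bot⟩
  refine cauchy_map_iff_exists_tendsto.1 (Metric.cauchy_iff.2 ⟨hF.map f, fun ε hε => ?_⟩)
  obtain ⟨g, ⟨l, hl⟩, hfg⟩ := h (ε / 4) (by linarith)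
  refine ⟨f '' {x | |g x - l| < ε / 4},
    image_mem_map (hl (Metric.ball_mem_nhds l (show 0 < ε / 4 by linarith))), ?_⟩
  rintro _ ⟨x, hx, rfl⟩ _ ⟨y, hy, rfl⟩
  have h1 := abs_le.1 (hfg x)
  have h2 := abs_le.1 (hfg y)
  have h3 := abs_lt.1 (show |g x - l| < ε / 4 from hx)
  have h4 := abs_lt.1 (show |g y - l| < ε / 4 from hy)
  rw [Real.dist_eq, abs_lt]
  constructor <;> linarith [h1.1, h1.2, h2.1, h2.2, h3.1, h3.2, h4.1, h4.2]

theorem tendsto_of_uniform_approx {X : Type*} {F : Filter X} {f : X → ℝ} {x : X}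
    (h : ∀ ε > 0, ∃ g : X → ℝ, Tendsto g F (𝓝 (g x)) ∧ ∀ y, |f y - g y| ≤ ε) :
    Tendsto f F (𝓝 (f x)) := by
  refine Metric.tendsto_nhds.2 fun ε hε => ?_
  obtain ⟨g, hg, hfg⟩ := h (ε / 4) (by linarith)
  filter_upwards [Metric.tendsto_nhds.1 hg (ε / 4) (by linarith)] with y hy
  have h1 := abs_le.1 (hfg x)
  have h2 := abs_le.1 (hfg y)
  rw [Real.dist_eq, abs_lt] at *
  constructor <;> linarith [h1.1, h1.2, h2.1, h2.2, hy.1, hy.2]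

theorem mem_DK_of_uniform_approx {f : Rect a b → ℝ}
    (h : ∀ ε > 0, ∃ g ∈ DK a b, ∀ x, |f x - g x| ≤ ε) : f ∈ DK a b := by
  refine fun x => ⟨fun ρ => exists_tendsto_of_uniform_approx fun ε hε => ?_,
    fun ρ hρ => tendsto_of_uniform_approx fun ε hε => ?_⟩
  · obtain ⟨g, hg, hfg⟩ := h ε hε
    exact ⟨g, (hg x).1 ρ, hfg⟩
  · obtain ⟨g, hg, hfg⟩ := h ε hε
    exact ⟨g, (hg x).2 ρ hρ, hfg⟩

theorem mem_DKTilde_of_uniform_approx {f : Rect a b → ℝ}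
    (h : ∀ ε > 0, ∃ g ∈ DKTilde a b, ∀ x, |f x - g x| ≤ ε) : f ∈ DKTilde a b := by
  refine ⟨mem_DK_of_uniform_approx fun ε hε => (h ε hε).imp fun g hg => ⟨hg.1.1, hg.2⟩,
    fun t => continuous_iff_continuousAt.2 fun ξ => tendsto_of_uniform_approx fun ε hε => ?_,
    fun ξ t => ⟨tendsto_of_uniform_approx fun ε hε => ?_,
      exists_tendsto_of_uniform_approx fun ε hε => ?_⟩⟩
  · obtain ⟨g, hg, hfg⟩ := h ε hε
    exact ⟨_, (hg.2.1 t).continuousAt, fun ξ => hfg (pt t ξ)⟩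
  · obtain ⟨g, hg, hfg⟩ := h ε hε
    exact ⟨_, (hg.2.2 ξ t).1, fun t => hfg (pt t ξ)⟩
  · obtain ⟨g, hg, hfg⟩ := h ε hε
    exact ⟨_, (hg.2.2 ξ t).2, fun t => hfg (pt t ξ)⟩

theorem continuous_warpAct (lam : Warps a b) : Continuous (warpAct lam) :=
  continuous_pi fun k => (lam k).continuous.comp (continuous_apply k)

theorem comp_warpAct_mem_DK (hab : ∀ k, a k < b k) {f : Rect a b → ℝ} (hf : f ∈ DK a b)
    (lam : Warps a b) : (fun x => f (warpAct lam x)) ∈ DK a b := by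
  have hlim : ∀ ρ x, Tendsto (warpAct lam) (𝓝[quadrant ρ x] x)
      (𝓝[quadrant ρ (warpAct lam x)] (warpAct lam x)) := fun ρ x =>
    tendsto_nhdsWithin_iff.2 ⟨((continuous_warpAct lam).tendsto x).mono_left nhdsWithin_le_nhds,
      eventually_nhdsWithin_of_forall fun y hy k => orderIso_mem_sideI (lam k) (hy k)⟩
  refine fun x => ⟨fun ρ => ?_, fun ρ hρ => ?_⟩
  · obtain ⟨l, hl⟩ := (hf (warpAct lam x)).1 ρ
    exact ⟨l, Tendsto.comp hl (hlim ρ x)⟩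
  · exact Tendsto.comp ((hf (warpAct lam x)).2 ρ fun k =>
      orderIso_mem_sideJ (hab k) (lam k) (hρ k)) (hlim ρ x)

theorem comp_warpAct_mem_DKTilde (hab : ∀ k, a k < b k) {f : Rect a b → ℝ}
    (hf : f ∈ DKTilde a b) (lam : Warps a b) :
    (fun x => f (warpAct lam x)) ∈ DKTilde a b := by
  refine ⟨comp_warpAct_mem_DK hab hf.1 lam, fun t => ?_, fun ξ t => ?_⟩
  · simp only [warpAct_pt]
    exact (hf.2.1 (lam 0 t)).comp
      (continuous_pi fun k => (lam k.succ).continuous.comp (continuous_apply k))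
  · simp only [warpAct_pt]
    obtain ⟨h1, l, h2⟩ := hf.2.2 (fun k => lam k.succ (ξ k)) (lam 0 t)
    refine ⟨ContinuousWithinAt.comp (f := lam 0) h1
      (lam 0).continuous.continuousWithinAt fun s hs => (lam 0).monotone hs, l, ?_⟩
    refine h2.comp (tendsto_nhdsWithin_iff.2 ⟨?_, ?_⟩)
    · exact ((lam 0).continuous.tendsto t).mono_left nhdsWithin_le_nhds
    · exact eventually_nhdsWithin_of_forall fun s hs => (lam 0).strictMono hs

theorem continuous_pt (t : Rect₁ a b) : Continuous fun ξ : Rect₂ a b => pt t ξ :=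
  continuous_pi fun k => Fin.cases continuous_const (fun k => continuous_apply k) k

theorem mem_DK_of_continuous {f : Rect a b → ℝ} (hf : Continuous f) : f ∈ DK a b :=
  fun x => ⟨fun _ => ⟨f x, (hf.tendsto x).mono_left nhdsWithin_le_nhds⟩,
    fun _ _ => (hf.tendsto x).mono_left nhdsWithin_le_nhds⟩

theorem mem_DKTilde_of_continuous {f : Rect a b → ℝ} (hf : Continuous f) : f ∈ DKTilde a b := by
  have h2 : ∀ ξ : Rect₂ a b, Continuous fun t : Rect₁ a b => f (pt t ξ) := fun ξ =>
    hf.comp (continuous_pi fun k => Fin.cases continuous_id (fun k => continuous_const) k)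
  exact ⟨mem_DK_of_continuous hf, fun t => hf.comp (continuous_pt t), fun ξ t =>
    ⟨(h2 ξ).continuousWithinAt, _, ((h2 ξ).tendsto t).mono_left nhdsWithin_le_nhds⟩⟩

end Space

/-! ### Comparison of the balls -/

section Space

variable {n : ℕ} {a b : Fin (n + 1) → ℝ}

theorem mem_closure_sideJ {u v : ℝ} {s : Bool} {x y : Icc u v} (hy : y ∈ sideJ s x) :
    x ∈ closure (sideJ s x) := by
  unfold sideJ at hy ⊢
  by_cases hx : (x : ℝ) < v
  · cases s
    · simp only [hx, if_true, Bool.false_eq_true, if_false] at hy ⊢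
      rw [closure_Iio' ⟨y, hy⟩]
      exact self_mem_Iic
    · exact subset_closure (by simp [hx])
  · cases s
    · exact subset_closure (by simp [hx])
    · simp [hx] at hy

/-- Near `x`, a function of `𝒟̃_K` varies little along the fibers `{t} × K₂`: every point of such a
fiber lies in one of the half-open quadrants of `x`, and the point of the fiber over the
`K₂`-component of `x` is in the closure of the part of the fiber in that quadrant. -/
theorem exists_ball_fiber_oscillation (hab : ∀ k, a k < b k) {f : Rect a b → ℝ}
    (hf : f ∈ DKTilde a b) (x : Rect a b) {ε : ℝ} (hε : 0 < ε) : ∃ δ : ℝ, 0 < δ ∧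
      ∀ y ∈ Metric.ball x δ, |f y - f (pt (y 0) fun k => x k.succ)| ≤ ε := by
  obtain ⟨δ, hδ, hosc⟩ := exists_ball_oscillation_lt hab hf.1 x hε
  refine ⟨δ, hδ, fun y hy => ?_⟩
  obtain ⟨ρ, hρ⟩ := exists_mem_quadrant' x y
  set ξ : Rect₂ a b := fun k => x k.succ with hξ
  set A : Set (Rect₂ a b) := univ.pi fun k => sideJ (ρ k.succ) (ξ k) with hA
  have hξA : ξ ∈ closure A := by
    rw [hA, closure_pi_set]
    exact fun k _ => mem_closure_sideJ (hρ k.succ)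
  have hne : (𝓝[A] ξ).NeBot := mem_closure_iff_nhdsWithin_neBot.1 hξA
  have hball : pt (y 0) ξ ∈ Metric.ball x δ := by
    refine (dist_pi_lt_iff hδ).2 fun k => Fin.cases ?_ (fun k => ?_) k
    · exact (dist_pi_lt_iff hδ).1 hy 0
    · rw [pt_succ, hξ, dist_self]
      exact hδ
  have hlim : Tendsto (fun η => |f y - f (pt (y 0) η)|) (𝓝[A] ξ) (𝓝 |f y - f (pt (y 0) ξ)|) :=
    ((continuous_const.sub (hf.2.1 (y 0))).abs.tendsto ξ).mono_left nhdsWithin_le_nhds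
  refine le_of_tendsto hlim ?_
  filter_upwards [self_mem_nhdsWithin, mem_nhdsWithin_of_mem_nhds
    (((continuous_pt (y 0)).isOpen_preimage _ Metric.isOpen_ball).mem_nhds hball)] with η hη hη'
  refine (hosc ρ y hy _ hη' hρ fun k => Fin.cases ?_ (fun k => ?_) k).le
  · exact hρ 0
  · exact hη k (mem_univ k)

/-- A function of `𝒟̃_K` is continuous in the `K₂`-variable, uniformly over `K`. -/
theorem exists_forall_fiber_dist_lt (hab : ∀ k, a k < b k) {f : Rect a b → ℝ}
    (hf : f ∈ DKTilde a b) {ε : ℝ} (hε : 0 < ε) : ∃ η : ℝ, 0 < η ∧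
      ∀ y z : Rect a b, y 0 = z 0 → dist z y < η → |f y - f z| ≤ ε := by
  choose δ hδ hosc using fun x => exists_ball_fiber_oscillation hab hf x (half_pos hε)
  obtain ⟨η, hη, hleb⟩ := lebesgue_number_lemma_of_metric (isCompact_univ (X := Rect a b))
    (c := fun x => Metric.ball x (δ x)) (fun x => Metric.isOpen_ball)
    (fun x _ => mem_iUnion.2 ⟨x, Metric.mem_ball_self (hδ x)⟩)
  refine ⟨η, hη, fun y z hyz hdist => ?_⟩
  obtain ⟨x, hx⟩ := hleb y (mem_univ y)
  have h1 := abs_le.1 (hosc x y (hx (Metric.mem_ball_self hη)))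
  have h2 := abs_le.1 (hosc x z (hx hdist))
  rw [hyz] at h1
  rw [abs_le]
  constructor <;> linarith [h1.1, h1.2, h2.1, h2.2]

theorem exists_ballIn_dK_subset (hab : ∀ k, a k < b k) {f : Rect a b → ℝ} (hf : f ∈ DKTilde a b)
    {r : ℝ} (hr : 0 < r) :
    ∃ δ : ℝ, 0 < δ ∧ ballIn (DK a b) dK f δ ⊆ ballIn (DK a b) dKTilde f r := by
  have hr4 : 0 < r / 4 := by linarith
  obtain ⟨η, hη, hosc⟩ := exists_forall_fiber_dist_lt hab hf hr4
  obtain ⟨c, hc, hmove⟩ := exists_pos_forall_dist_warpAct_lt a b hη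
  refine ⟨min c (r / 4), lt_min hc hr4, fun g hg => ⟨hg.1, ?_⟩⟩
  obtain ⟨lam, hlam, hfg⟩ := exists_of_dK_lt hg.2
  have hc' : warpsSize lam ≤ ENNReal.ofReal c :=
    hlam.trans (ENNReal.ofReal_le_ofReal (min_le_left _ _))
  have hr' : warpSize (lam 0) ≤ ENNReal.ofReal (r / 4) :=
    (warpSize_le_warpsSize lam 0).trans (hlam.trans (ENNReal.ofReal_le_ofReal (min_le_right _ _)))
  refine (dKTilde_le_of_forall (e := r / 2) hr4.le (by linarith) (lam 0) hr'
    fun t ξ => ?_).trans_lt ((ENNReal.ofReal_lt_ofReal_iff hr).2 (by linarith))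
  -- Undoing the time change of the `K₂`-variable moves `ξ` only a little.
  have hy : warpAct lam⁻¹ (pt (lam 0 t) ξ) = pt t fun k => (lam k.succ)⁻¹ (ξ k) := by
    rw [warpAct_pt, Pi.inv_apply, RelIso.inv_apply_self]; rfl
  have hdist : dist (pt t fun k => (lam k.succ)⁻¹ (ξ k)) (pt t ξ) < η := by
    have h := (dist_pi_lt_iff hη).1 (hmove lam⁻¹ (by rwa [warpsSize_inv]) (pt (lam 0 t) ξ))
    refine (dist_pi_lt_iff hη).2 fun k => Fin.cases ?_ (fun k => ?_) k
    · rw [pt_zero, pt_zero, dist_self]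
      exact hη
    · exact h k.succ
  have h1 := hosc (pt t ξ) (pt t fun k => (lam k.succ)⁻¹ (ξ k)) rfl hdist
  have h2 := (hfg (warpAct lam⁻¹ (pt (lam 0 t) ξ))).le.trans (min_le_right _ _)
  rw [warpAct_self_inv, hy] at h2
  have h3 := abs_sub_le (f (pt t ξ)) (f (pt t fun k => (lam k.succ)⁻¹ (ξ k)))
    (g (pt (lam 0 t) ξ))
  linarith

theorem exists_ballIn_dKTilde_subset {f : Rect a b → ℝ} (hf : Continuous f) {r : ℝ} (hr : 0 < r) :
    ∃ δ : ℝ, 0 < δ ∧ ballIn (DK a b) dKTilde f δ ⊆ ballIn (DK a b) supDist f r := by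
  have hr4 : 0 < r / 4 := by linarith
  obtain ⟨η, hη, hosc⟩ := Metric.uniformContinuous_iff.1
    (CompactSpace.uniformContinuous_of_continuous hf) (r / 4) hr4
  obtain ⟨c, hc, hmove⟩ := exists_pos_forall_dist_warpAct_lt a b hη
  refine ⟨min c (r / 4), lt_min hc hr4, fun g hg => ⟨hg.1, ?_⟩⟩
  obtain ⟨lam, hlam, hfg⟩ := exists_of_dKTilde_lt hg.2
  refine lt_of_le_of_lt (iSup_le fun x => ENNReal.ofReal_le_ofReal ?_)
    ((ENNReal.ofReal_lt_ofReal_iff hr).2 (show r / 2 < r by linarith))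
  have hsize : warpsSize (firstWarp lam⁻¹) ≤ ENNReal.ofReal c := by
    refine (warpsSize_firstWarp_le _).trans ?_
    rw [warpSize_inv]
    exact hlam.trans (ENNReal.ofReal_le_ofReal (min_le_left _ _))
  have h1 := hosc (hmove _ hsize x)
  have h2 := (hfg (lam⁻¹ (x 0)) fun k => x k.succ).le.trans (min_le_right _ _)
  rw [RelIso.apply_inv_self, ← warpAct_firstWarp, pt_eta] at h2
  rw [dist_comm, Real.dist_eq] at h1
  have h3 := abs_sub_le (f x) (f (warpAct (firstWarp lam⁻¹) x)) (g x)
  change |f x - g x| ≤ r / 2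
  linarith

/-! ### Separability -/

/-- The step function coded by `c = ⟨T, h⟩`: its grid points are the rationals in `T k` on the `k`-th
axis, and `h` gives the value on each cell, a cell being described by telling which grid points
lie below it. -/
noncomputable def ratStep (c : Σ T : Fin (n + 1) → Finset ℚ, (∀ k, T k → Bool) → ℚ)
    (x : Rect a b) : ℝ :=
  c.2 fun k q => decide ((q.1 : ℝ) ≤ x k)

/-- Rational step functions are dense: a time change moves the grid points of a step function to
rational points. -/
theorem exists_dK_ratStep_le (hab : ∀ k, a k < b k) {f : Rect a b → ℝ} (hf : f ∈ DK a b) {ε : ℝ}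
    (hε : 0 < ε) : ∃ c, dK f (ratStep c) ≤ ENNReal.ofReal ε := by
  classical
  have hε3 : 0 < ε / 3 := by linarith
  obtain ⟨S, hS, h, hh⟩ := exists_step_approx hab hf hε3
  choose lam hlam hq using fun k => exists_orderIso_rat (hab k) (S k) (hS k) hε3
  choose q hq using hq
  choose p hp using fun c => exists_rat_near (h c) hε3
  let T : Fin (n + 1) → Finset ℚ := fun k => (S k).attach.image fun s => q k s.1 s.2
  have hT : ∀ k (s : S k), q k s.1 s.2 ∈ T k := fun k s =>
    Finset.mem_image_of_mem (fun s : S k => q k s.1 s.2) (Finset.mem_attach _ s)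
  refine ⟨⟨T, fun d => p fun k s => d k ⟨q k s.1 s.2, hT k s⟩⟩, ?_⟩
  have hsum : ε = ε / 3 + (ε / 3 + ε / 3) := by ring
  rw [hsum]
  refine dK_le_of_forall hε3.le (by linarith) lam (warpsSize_le_iff.2 hlam) fun x => ?_
  have hcell : (fun k (s : S k) => decide ((q k s.1 s.2 : ℝ) ≤ warpAct lam x k)) =
      fun k (s : S k) => decide (s.1 ≤ x k) := by
    funext k s
    rw [← hq k s.1 s.2]
    exact decide_eq_decide.2 (lam k).le_iff_le
  simp only [ratStep]
  rw [hcell]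
  have h3 := abs_sub_le (f x) (h fun k s => decide (s.1 ≤ x k))
    (p fun k s => decide (s.1 ≤ x k))
  linarith [hh x, hp fun k s => decide (s.1 ≤ x k)]

theorem exists_countable_dense_DK (hab : ∀ k, a k < b k) {r : ℝ} (hr : 0 < r) :
    ∃ t : Set (DK a b), t.Countable ∧ ∀ f : DK a b, ∃ g ∈ t,
      dK (f : Rect a b → ℝ) (g : Rect a b → ℝ) ≤ ENNReal.ofReal r := by
  let C := {c : Σ T : Fin (n + 1) → Finset ℚ, (∀ k, T k → Bool) → ℚ //
    ∃ g : DK a b, dK (g : Rect a b → ℝ) (ratStep c) ≤ ENNReal.ofReal (r / 2)}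
  choose G hG using fun c : C => c.2
  refine ⟨range G, countable_range G, fun f => ?_⟩
  obtain ⟨c, hc⟩ := exists_dK_ratStep_le hab f.2 (half_pos hr)
  refine ⟨G ⟨c, f, hc⟩, mem_range_self _, ?_⟩
  refine (dK_triangle (f : Rect a b → ℝ) (ratStep c) _).trans ?_
  rw [dK_comm (ratStep c)]
  refine (add_le_add hc (hG ⟨c, f, hc⟩)).trans ?_
  rw [← ENNReal.ofReal_add (half_pos hr).le (half_pos hr).le, add_halves]

/-! ### Completeness -/

/-- A fast Cauchy sequence converges: after composing its members with suitable time changes, it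
converges uniformly, and these time changes converge in the group of all time changes. -/
theorem exists_dK_limit (hab : ∀ k, a k < b k) {u : ℕ → Rect a b → ℝ} (hu : ∀ i, u i ∈ DK a b)
    (h : ∀ i, dK (u i) (u (i + 1)) < ENNReal.ofReal ((1 / 2) ^ i)) :
    ∃ f ∈ DK a b, ∀ i, dK (u i) f ≤ ENNReal.ofReal (4 * (1 / 2) ^ i) := by
  choose lam hlam hdist using fun i => exists_of_dK_lt (h i)
  let sig : ℕ → Warps a b := fun i => Nat.rec 1 (fun i s => lam i * s) i
  have hsig : ∀ i, sig (i + 1) = lam i * sig i := fun i => rfl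
  choose mu hmu using fun k => exists_orderIso_limit (hab k).le (sig := fun i => sig i k)
    (fun i => by
      rw [hsig, Pi.mul_apply, mul_inv_cancel_right]
      exact (warpSize_le_warpsSize (lam i) k).trans (hlam i))
  have hgeo : ∀ x i, dist (u i (warpAct (sig i) x)) (u (i + 1) (warpAct (sig (i + 1)) x)) ≤
      1 * (1 / 2) ^ i := fun x i => by
    rw [hsig, warpAct_mul, one_mul]
    exact (hdist i _).le
  choose G hG using fun x => cauchySeq_tendsto_of_complete
    (cauchySeq_of_le_geometric (1 / 2) 1 (by norm_num) (hgeo x))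
  have hunif : ∀ x i, |G x - u i (warpAct (sig i) x)| ≤ 2 * (1 / 2) ^ i := fun x i => by
    have := dist_le_of_le_geometric_of_tendsto (1 / 2) 1 (by norm_num) (hgeo x) (hG x) i
    rw [dist_comm, Real.dist_eq] at this
    refine this.trans (le_of_eq ?_)
    ring
  have hGD : G ∈ DK a b := mem_DK_of_uniform_approx fun ε hε => by
    obtain ⟨i, hi⟩ := exists_pow_lt_of_lt_one (half_pos hε) (show (1 : ℝ) / 2 < 1 by norm_num)
    exact ⟨_, comp_warpAct_mem_DK hab (hu i) (sig i), fun x => (hunif x i).trans (by linarith)⟩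
  refine ⟨_, comp_warpAct_mem_DK hab hGD mu⁻¹, fun i => ?_⟩
  rw [dK_comm]
  have h4 : (4 : ℝ) * (1 / 2) ^ i = 2 * (1 / 2) ^ i + 2 * (1 / 2) ^ i := by ring
  rw [h4]
  exact dK_le_of_forall (by positivity) (by positivity) (sig i * mu⁻¹)
    (warpsSize_le_iff.2 fun k => hmu k i) fun x => hunif (warpAct mu⁻¹ x) i

/-! ### Polish spaces -/

theorem polishSpace_DK (hab : ∀ k, a k < b k) :
    @PolishSpace (DK a b) (topologyOn (DK a b) dK) := by
  refine (isMetricOn_dK hab).polishSpace (fun r hr => exists_countable_dense_DK hab hr)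
    fun u hu h => ?_
  obtain ⟨f, hf, hlim⟩ := exists_dK_limit hab hu h
  refine ⟨f, hf, tendsto_of_tendsto_of_tendsto_of_le_of_le tendsto_const_nhds ?_
    (fun _ => bot_le) hlim⟩
  have h1 : Tendsto (fun i : ℕ => 4 * ((1 : ℝ) / 2) ^ i) atTop (𝓝 0) := by
    simpa using (tendsto_pow_atTop_nhds_zero_of_lt_one (r := (1 : ℝ) / 2) (by norm_num)
      (by norm_num)).const_mul 4
  simpa using ENNReal.tendsto_ofReal h1

theorem isClosed_DKTilde (hab : ∀ k, a k < b k) :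
    IsClosed[topologyOn (DK a b) dK] {f : DK a b | (f : Rect a b → ℝ) ∈ DKTilde a b} := by
  refine (isMetricOn_dK hab).isClosed fun f _ h => mem_DKTilde_of_uniform_approx fun ε hε => ?_
  obtain ⟨g, hg, hfg⟩ := h ε hε
  obtain ⟨lam, -, hlam⟩ := exists_of_dK_lt hfg
  exact ⟨_, comp_warpAct_mem_DKTilde hab hg lam, fun x => (hlam x).le⟩

theorem DKTilde_subset_DK : DKTilde a b ⊆ DK a b := fun _ hf => hf.1

theorem topologyOn_DKTilde_eq (hab : ∀ k, a k < b k) :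
    topologyOn (DKTilde a b) dK = topologyOn (DKTilde a b) dKTilde :=
  topologyOn_eq DKTilde_subset_DK (fun f _ g _ => dK_le_dKTilde f g)
    fun _ hf _ hr => exists_ballIn_dK_subset hab hf hr

theorem polishSpace_DKTilde (hab : ∀ k, a k < b k) :
    @PolishSpace (DKTilde a b) (topologyOn (DKTilde a b) dKTilde) := by
  rw [← topologyOn_DKTilde_eq hab]
  exact (isMetricOn_dK hab).polishSpace_of_isClosed DKTilde_subset_DK (polishSpace_DK hab)
    (isClosed_DKTilde hab)

end Space

end Skorohod

theorem lemma2p5 {n : ℕ} (a b : Fin (n + 1) → ℝ) (hab : ∀ k, a k < b k) :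
    -- `d_K`, `d̃_K` and the sup-norm distance are metrics on `𝒟_K`
    (IsMetricOn (DK a b) dK ∧ IsMetricOn (DK a b) dKTilde ∧ IsMetricOn (DK a b) supDist) ∧
    -- comparison of the three metrics
    (∀ f ∈ DK a b, ∀ g ∈ DK a b, dK f g ≤ dKTilde f g ∧ dKTilde f g ≤ supDist f g) ∧
    -- `d_K` and `d̃_K` at elements of `𝒟̃_K`, and their topologies on `𝒟̃_K`
    ((∀ f ∈ DKTilde a b, ∀ r : ℝ, 0 < r → ∃ δ : ℝ, 0 < δ ∧
        ballIn (DK a b) dK f δ ⊆ ballIn (DK a b) dKTilde f r) ∧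
      topologyOn (DKTilde a b) dK = topologyOn (DKTilde a b) dKTilde) ∧
    -- the three metrics at continuous functions, and their topologies on the space of these
    ((∀ f : Rect a b → ℝ, Continuous f → f ∈ DK a b) ∧
      (∀ f : Rect a b → ℝ, Continuous f → ∀ r : ℝ, 0 < r → ∃ δ : ℝ, 0 < δ ∧
        ballIn (DK a b) dKTilde f δ ⊆ ballIn (DK a b) supDist f r) ∧
      topologyOn {f : Rect a b → ℝ | Continuous f} dK =
        topologyOn {f : Rect a b → ℝ | Continuous f} dKTilde ∧
      topologyOn {f : Rect a b → ℝ | Continuous f} dKTilde =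
        topologyOn {f : Rect a b → ℝ | Continuous f} supDist) ∧
    -- `𝒟̃_K` is closed in the Polish space `(𝒟_K, d_K)`, and `(𝒟̃_K, d̃_K)` is Polish
    (@PolishSpace (DK a b) (topologyOn (DK a b) dK) ∧
      IsClosed[topologyOn (DK a b) dK] {f : DK a b | (f : Rect a b → ℝ) ∈ DKTilde a b} ∧
      @PolishSpace (DKTilde a b) (topologyOn (DKTilde a b) dKTilde)) := by
  refine ⟨⟨isMetricOn_dK hab, isMetricOn_dKTilde hab, isMetricOn_supDist hab⟩,
    fun f _ g _ => ⟨dK_le_dKTilde f g, dKTilde_le_supDist f g⟩,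
    ⟨fun f hf r hr => exists_ballIn_dK_subset hab hf hr, topologyOn_DKTilde_eq hab⟩,
    ⟨fun f hf => mem_DK_of_continuous hf, fun f hf r hr => exists_ballIn_dKTilde_subset hf hr,
      topologyOn_eq (S := DK a b) (fun f hf => mem_DK_of_continuous hf)
        (fun f _ g _ => dK_le_dKTilde f g)
        fun f hf r hr => exists_ballIn_dK_subset hab (mem_DKTilde_of_continuous hf) hr,
      topologyOn_eq (S := DK a b) (fun f hf => mem_DK_of_continuous hf)
        (fun f _ g _ => dKTilde_le_supDist f g)
        fun f hf r hr => exists_ballIn_dKTilde_subset hf hr⟩,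
    polishSpace_DK hab, isClosed_DKTilde hab, polishSpace_DKTilde hab⟩
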